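/- Let $(\Omega,\mathcal F,\nu)$ be a probability space and let $\phi:\mathbb R\to[0,+\infty]$ be convex and lower semicontinuous, with $\phi(1)=0$, $\phi=+\infty$ on $(-\infty,0)$, and $\phi<\infty$ in a neighbourhood of $1$. Write $f^{*}(y)=\sup_{x\in\mathbb R}\{xy-f(x)\}$ for the convex conjugate, $\phi'(\pm\infty)=\lim_{x\to\pm\infty}\phi(x)/x$, $\psi(x)=\phi(x+1)$ and $\theta(x)=\max\{\psi^{*}(x),\psi^{*}(-x)\}$. For a finite signed measure $\mu$ with Lebesgue decomposition $\mu=\mu_c+\mu_s$ relative to $\nu$ let $$D_\phi(\mu\|\nu)=\int\phi\Big(\frac{d\mu_c}{d\nu}\Big)d\nu+\mu_s^{+}(\Omega)\,\phi'(\infty)-\mu_s^{-}(\Omega)\,\phi'(-\infty),\qquad 0\cdot(\pm\infty)=0 .$$ For $g\in L^0(\nu)$ let $$K_{g,\nu}(t)=\inf\Big\{\int\psi^{*}(tg+\lambda)\,d\nu\;:\;\lambda\in\mathbb R,\ \lambda+\operatorname{ess\,sup}_\nu(tg)\le\phi'(\infty)\Big\},\qquad t\in\mathbb R,$$ and call $g$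 strongly $(\phi,\nu)$-subexponential if $K_{g,\nu}(t)<\infty$ for every $t\in\mathbb R$; let $S(\nu)$ be the set of these $g$. Let $L^{\theta^{*}}(\nu)=\{f\in L^0(\nu):\exists\alpha>0,\ \int\theta^{*}(\alpha f)\,d\nu<\infty\}$ be the Orlicz space of $\theta^*$. Assume $\phi'(\infty)=\infty$. Then: 1. $S(\nu)$ is the Orlicz heart $\{g\in L^0(\nu):\forall\alpha>0,\ \int\theta(\alpha g)\,d\nu<\infty\}$ of $\theta$; the pairing $\langle f,g\rangle=\int fg\,d\nu$ is well defined on $L^{\theta^{*}}(\nu)\times S(\nu)$ and separates points on both sides; and every $f\in L^{\theta^*}(\nu)$ is $\nu$-integrable with $D_\phi(f\nu\|\nu)=\int\phi\circ f\,d\nu$. 2. For the weak topology $\sigma(L^{\theta^{*}}(\nu),S(\nu))$, the functional $f\mapsto\int\phi\circ f\,d\nu=D_\phi(f\nu\|\nu)$ on $L^{\theta^{*}}(\nu)$ is inf-compact: the set $\{f\in L^{\theta^*}(\nu):\int\phi\circ f\,d\nu\le t\}$ is compact for every $t\in\mathbb R$. 3. For every $\tau\in\mathbb R$, every $\mu$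 in the information ball $B(\tau)=\{\mu : D_\phi(\mu\|\nu)\le\tau\}$ of finite signed measures is absolutely continuous with respect to $\nu$ and integrates every $g\in S(\nu)$, and both $B(\tau)$ and its subset of probability measures are compact in the initial topology induced by the maps $\mu\mapsto\mu(g)=\int g\,d\mu$, $g\in S(\nu)$. 4. Let $g\in S(\nu)$ and let $M$ be a convex set of $\nu$-absolutely continuous probability measures that contains every $\nu$-absolutely continuous probability measure $\mu$ with $D_\phi(\mu\|\nu)<\infty$. Then the optimal lower bound $$L(\varepsilon)=\inf\{D_\phi(\mu\|\nu):\mu\in M,\ \mu \text{ integrates } g,\ \mu(g)-\nu(g)=\varepsilon\}\qquad(\inf\emptyset=+\infty)$$ is lower semicontinuous on $\mathbb R$, and strong duality holds: $L(\varepsilon)=L^{**}(\varepsilon)=K_{g,\nu}^{*}(\varepsilon)=\sup_{t\in\mathbb R}\{t\varepsilon-K_{g,\nu}(t)\}$ for every $\varepsilon\in\mathbb R$. -/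

import Mathlib

open MeasureTheory Filter Topology
open scoped ENNReal

noncomputable section

namespace PhiDiv

/-! ### Extended-real convex functions on the line -/

/-- The convex conjugate `f*(y) = sup_x (x y - f(x))`. -/
def conj (f : ℝ → EReal) (y : ℝ) : EReal :=
  ⨆ x : ℝ, (((x * y : ℝ) : EReal) - f x)

/-- The slope at infinity `f'(ℓ) = lim_{x → ℓ} f(x) / x`, where `l` is `atTop` or `atBot`.
The limit exists in `[-∞, ∞]` for every proper convex `f`. -/
def slopeAt (f : ℝ → EReal) (l : Filter ℝ) : EReal :=
  limUnder l (fun x : ℝ => f x / (x : EReal))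

/-- The functions `φ` that define divergences of probability measures, in normalized form:
convex and lower semicontinuous with values in `ℝ ∪ {∞}`, `φ(1) = 0`, `0 ∈ ∂φ(1)` (that is,
`φ ≥ 0`), `φ = ∞` on the negative reals, and finite in a neighbourhood of `1`. -/
structure IsGenerator (φ : ℝ → EReal) : Prop where
  convex : Convex ℝ {p : ℝ × ℝ | φ p.1 ≤ (p.2 : EReal)}
  lsc : LowerSemicontinuous φ
  map_one : φ 1 = 0
  nonneg : ∀ x, 0 ≤ φ x
  eq_top_of_neg : ∀ x, x < 0 → φ x = ⊤
  finite_near_one : ∀ᶠ x in 𝓝 (1 : ℝ), φ x < ⊤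

/-- `ψ(x) = φ(x + 1)`. -/
def psi (φ : ℝ → EReal) (x : ℝ) : EReal := φ (x + 1)

/-- `θ(x) = max (ψ*(x), ψ*(-x))`. -/
def theta (φ : ℝ → EReal) (x : ℝ) : EReal := max (conj (psi φ) x) (conj (psi φ) (-x))

/-- A function on a space with compact sublevel sets `{F ≤ t}`, `t` real. -/
def InfCompact {X : Type*} (τ : TopologicalSpace X) (F : X → EReal) : Prop :=
  ∀ t : ℝ, @IsCompact X τ {x | F x ≤ (t : EReal)}

variable {Ω : Type*} [MeasurableSpace Ω]

/-! ### Integral functionals and Orlicz spaces -/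

/-- The integral functional `I_{f,ν}(h) = ∫ f ∘ h dν`, for `f ≥ 0` (as are all the functions
`φ`, `ψ*`, `θ`, `θ*` it is used for). -/
def intFun (f : ℝ → EReal) (ν : Measure Ω) (h : Ω → ℝ) : ℝ≥0∞ :=
  ∫⁻ ω, (f (h ω)).toENNReal ∂ν

/-- The Orlicz space `L^θ(ν)`. -/
def orliczSpace (θ : ℝ → EReal) (ν : Measure Ω) : Set (Ω →ₘ[ν] ℝ) :=
  {f | ∃ α : ℝ, 0 < α ∧ intFun θ ν (fun ω => α * f ω) < ⊤}

/-- The Orlicz heart of `L^θ(ν)`. -/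
def orliczHeart (θ : ℝ → EReal) (ν : Measure Ω) : Set (Ω →ₘ[ν] ℝ) :=
  {f | ∀ α : ℝ, 0 < α → intFun θ ν (fun ω => α * f ω) < ⊤}

/-- The `(φ, ν)`-cumulant generating function
`K_{g,ν}(t) = inf {∫ ψ*(t g + lam) dν : lam ∈ ℝ, lam + esssup_ν (t g) ≤ φ'(∞)}`. -/
def cgf (φ : ℝ → EReal) (ν : Measure Ω) (g : Ω →ₘ[ν] ℝ) (t : ℝ) : EReal :=
  ⨅ (lam : ℝ) (_ : (lam : EReal) + essSup (fun ω => ((t * g ω : ℝ) : EReal)) ν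
      ≤ slopeAt φ atTop),
    ((intFun (conj (psi φ)) ν (fun ω => t * g ω + lam) : ℝ≥0∞) : EReal)

/-- The set `S(ν)` of strongly `(φ, ν)`-subexponential functions: `dom K_{g,ν} = ℝ`. -/
def stronglySubexp (φ : ℝ → EReal) (ν : Measure Ω) : Set (Ω →ₘ[ν] ℝ) :=
  {g | ∀ t : ℝ, cgf φ ν g t < ⊤}

/-- The pairing `(f, g) ↦ ∫ f g dν` is well defined on `X × Y` and separates points. -/
structure SeparatingPairing (ν : Measure Ω) (X Y : Set (Ω →ₘ[ν] ℝ)) : Prop where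
  integrable : ∀ f ∈ X, ∀ g ∈ Y, Integrable (fun ω => f ω * g ω) ν
  left : ∀ f ∈ X, (∀ g ∈ Y, ∫ ω, f ω * g ω ∂ν = 0) → f = 0
  right : ∀ g ∈ Y, (∀ f ∈ X, ∫ ω, f ω * g ω ∂ν = 0) → g = 0

/-- The weak topology `σ(X, Y)` on `X` for the pairing `(f, g) ↦ ∫ f g dν`. -/
@[reducible] def weakTopology (ν : Measure Ω) (X Y : Set (Ω →ₘ[ν] ℝ)) : TopologicalSpace X :=
  ⨅ g ∈ Y, TopologicalSpace.induced (fun f : X => ∫ ω, f.1 ω * g ω ∂ν) inferInstance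

/-! ### Divergences of finite signed measures -/

/-- The integral `μ(g) = ∫ g dμ⁺ - ∫ g dμ⁻` for a finite signed measure `μ` with Hahn-Jordan
decomposition `μ = μ⁺ - μ⁻`; meaningful when `g` is integrable for `|μ|`. -/
def sint (μ : SignedMeasure Ω) (g : Ω → ℝ) : ℝ :=
  ∫ ω, g ω ∂μ.toJordanDecomposition.posPart - ∫ ω, g ω ∂μ.toJordanDecomposition.negPart

/-- The `φ`-divergence
`D(μ‖ν) = ∫ φ(dμ_c/dν) dν + μ_s⁺(Ω) φ'(∞) - μ_s⁻(Ω) φ'(-∞)` of a finite signed measure `μ`, where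
`μ = μ_c + μ_s` is the Lebesgue decomposition with respect to `ν` (`0 * ∞ = 0` in `EReal`). -/
def div (φ : ℝ → EReal) (μ : SignedMeasure Ω) (ν : Measure Ω) : EReal :=
  (intFun φ ν (μ.rnDeriv ν) : EReal)
    + ((μ.singularPart ν).toJordanDecomposition.posPart Set.univ : EReal) * slopeAt φ atTop
    - ((μ.singularPart ν).toJordanDecomposition.negPart Set.univ : EReal) * slopeAt φ atBot

/-- The probability measures, as a set of signed measures. -/
def probs (Ω : Type*) [MeasurableSpace Ω] : Set (SignedMeasure Ω) :=
  {μ | 0 ≤ μ ∧ μ Set.univ = 1}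

/-- The information ball of radius `τ`: all finite signed measures with `D(μ‖ν) ≤ τ`. -/
def ball (φ : ℝ → EReal) (ν : Measure Ω) (τ : ℝ) : Set (SignedMeasure Ω) :=
  {μ | div φ μ ν ≤ (τ : EReal)}

/-- The initial topology on a set `A` of signed measures induced by the maps `μ ↦ μ(g)`,
`g ∈ S`. It is used for sets `A` of `ν`-absolutely continuous measures, on which `μ(g)` does not
depend on the representative of `g`. -/
@[reducible] def initialTopology {ν : Measure Ω} (S : Set (Ω →ₘ[ν] ℝ)) (A : Set (SignedMeasure Ω)) :
    TopologicalSpace A :=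
  ⨅ g ∈ S, TopologicalSpace.induced (fun μ : A => sint μ.1 g) inferInstance

/-- The optimal lower bound
`L_{g,ν}(ε) = inf {D(μ‖ν) : μ ∈ M integrates g and μ(g) - ν(g) = ε}`, with `inf ∅ = ∞`. -/
def optLB (φ : ℝ → EReal) (ν : Measure Ω) (M : Set (SignedMeasure Ω)) (g : Ω →ₘ[ν] ℝ)
    (ε : ℝ) : EReal :=
  ⨅ (μ : SignedMeasure Ω)
    (_ : μ ∈ M ∧ Integrable g μ.totalVariation ∧ sint μ g - ∫ ω, g ω ∂ν = ε), div φ μ ν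

end PhiDiv

end

namespace PhiDiv

section Conjugate

/-! ### Convex conjugates on the line -/

/-! Superlinearity of `φ` makes `ψ*` finite on all of `ℝ`, hence a continuous convex function
`legendre φ`, and it removes the constraint on `lam` in `cgf`. So `θ` is a finite even Young
function `young φ`, and midpoint convexity absorbs the shift `lam`: strongly subexponential
functions are exactly the Orlicz heart. Infinite slopes at both ends force a measure of finite
divergence to be absolutely continuous, and `φ = ∞` on the negatives makes its density nonnegative,
so everything reduces to centred densities `u = f - 1` with `∫ ψ(u) dν` bounded.

The working tool is the integrated Young inequality `integral_mul_le`. Applied to `k * h` and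
divided by `k`, it bounds `∫ u h` by `(T + ∫ θ(k h)) / k`, uniformly over the densities with `∫ ψ(u)
≤ T`; a large `k` makes the first term small. On indicators this is uniform absolute continuity, so
the limit of `∫ u_i 1_A` along an ultrafilter is a signed measure with a density `v`. On differences
`h - s` with `s` simple it carries the convergence from simple functions to the whole heart. The
bound `∫ ψ(v) ≤ t` survives because `ψ` is the conjugate of `ψ*` and the supremum may be
interchanged with the integral (`lintegral_psi_le`). This is `exists_tendsto_integral_mul`, the
source of every compactness statement.

For duality, let `valueEpi` collect the triples (`∫ u g`, `∫ u`, a bound for `∫ ψ(u)`). It is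
convex, and the same compactness makes it closed. If `((ε, 0), r)` lies outside, a separating affine
function has slopes `(t, lam)`, and the dual interchange (`lintegral_legendre_le`) turns its
constant into a bound on `∫ ψ*(t g + lam)`; hence `r < K*(ε)`. The reverse inequality is Young's.
The optimal bound is therefore itself a conjugate, so it is lower semicontinuous and equal to its
biconjugate. -/

/-- Testing on epigraph points `(x, s)` replaces extended-real subtraction by real inequalities;
later conjugate estimates go through this form. -/
theorem conj_le_coe_iff {f : ℝ → EReal} {y c : ℝ} :
    conj f y ≤ (c : EReal) ↔ ∀ x s : ℝ, f x ≤ (s : EReal) → x * y - s ≤ c := by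
  unfold conj
  rw [iSup_le_iff]
  refine forall_congr' fun x => ⟨fun h s hs => ?_, fun h => ?_⟩
  · have := (EReal.sub_le_sub (le_refl ((x * y : ℝ) : EReal)) hs).trans h
    exact_mod_cast this
  · induction hx : f x with
    | bot =>
      -- Where `f x = ⊥` every real `s` is admissible, and this one violates the bound by exactly
      -- `1`.
      have := h (x * y - c - 1) (by simp [hx])
      linarith
    | coe r => exact_mod_cast h r hx.le
    | top => simp

theorem sub_le_conj (f : ℝ → EReal) (x y : ℝ) : ((x * y : ℝ) : EReal) - f x ≤ conj f y :=
  le_iSup (fun x : ℝ => ((x * y : ℝ) : EReal) - f x) x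

theorem conj_antitone {f g : ℝ → EReal} (h : ∀ x, f x ≤ g x) (y : ℝ) : conj g y ≤ conj f y :=
  iSup_mono fun x => EReal.sub_le_sub le_rfl (h x)

theorem conj_conj_le (f : ℝ → EReal) (x : ℝ) : conj (conj f) x ≤ f x := by
  refine iSup_le fun y => ?_
  have h := sub_le_conj f x y
  rw [mul_comm] at h
  induction hx : f x with
  | bot =>
    rw [hx] at h
    have : conj f y = ⊤ := by rwa [EReal.coe_sub_bot, top_le_iff] at h
    simp [this]
  | coe r =>
    rw [hx] at h
    refine (EReal.sub_le_sub le_rfl h).trans ?_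
    rw [← EReal.coe_sub, ← EReal.coe_sub, EReal.coe_le_coe_iff]
    linarith
  | top => exact le_top

theorem conj_conj_conj (f : ℝ → EReal) (y : ℝ) : conj (conj (conj f)) y = conj f y :=
  le_antisymm (conj_conj_le _ y) (conj_antitone (conj_conj_le f) y)

theorem lowerSemicontinuous_conj (f : ℝ → EReal) : LowerSemicontinuous (conj f) := by
  refine lowerSemicontinuous_iSup fun x => ?_
  refine Continuous.lowerSemicontinuous (f := fun y : ℝ => ((x * y : ℝ) : EReal) - f x) ?_
  induction hx : f x with
  | bot =>
    simp only [EReal.coe_sub_bot]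
    exact continuous_const
  | coe r =>
    have : (fun y : ℝ => ((x * y : ℝ) : EReal) - (r : EReal)) =
        fun y : ℝ => ((x * y - r : ℝ) : EReal) := by
      ext y; rw [EReal.coe_sub]
    rw [this]
    exact continuous_coe_real_ereal.comp (by fun_prop)
  | top => simpa using (continuous_const : Continuous fun _ : ℝ => (⊥ : EReal))

/-- A point outside a closed convex epigraph contained in the upper half space lies strictly
below an affine minorant. -/
theorem exists_affine_minorant {E : Type*} [NormedAddCommGroup E] [NormedSpace ℝ E]
    {C : Set (E × ℝ)} (hconv : Convex ℝ C) (hclosed : IsClosed C)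
    (hup : ∀ x s s', (x, s) ∈ C → s ≤ s' → (x, s') ∈ C) (hzero : (0, 0) ∈ C)
    (hnonneg : ∀ p ∈ C, 0 ≤ p.2) {x₀ : E} {r : ℝ} (hr : (x₀, r) ∉ C) :
    ∃ (l : E →L[ℝ] ℝ) (c : ℝ), (∀ p ∈ C, l p.1 - p.2 ≤ c) ∧ c < l x₀ - r := by
  obtain ⟨f, u, hf, hu⟩ := geometric_hahn_banach_closed_point hconv hclosed hr
  set l : E →L[ℝ] ℝ := f.comp (ContinuousLinearMap.inl ℝ E ℝ) with hl
  set k : ℝ := -f (0, 1) with hk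
  have hdec : ∀ x s, f (x, s) = l x - k * s := by
    intro x s
    have : (x, s) = (x, (0 : ℝ)) + s • ((0 : E), (1 : ℝ)) := by simp
    rw [this, map_add, map_smul]
    simp only [hl, hk, ContinuousLinearMap.comp_apply, ContinuousLinearMap.inl_apply, smul_eq_mul]
    ring
  have hu0 : 0 < u := by
    have := hf _ hzero
    rwa [hdec, map_zero, mul_zero, sub_zero] at this
  have hk0 : 0 ≤ k := by
    by_contra! hk0
    -- If `k` were negative, moving up the vertical axis from the origin would reach a point of `C`
    -- where `f` takes the forbidden value `u`.
    have h := hf (0, u / (-k)) (hup 0 0 _ hzero (by have := neg_pos.2 hk0; positivity))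
    rw [hdec, map_zero] at h
    have : k * (u / -k) = -u := by
      have := hk0.ne
      rw [div_neg, mul_neg, mul_div_cancel₀ _ this]
    linarith
  rw [hdec] at hu
  rcases hk0.eq_or_lt with hk0 | hk0
  · have hd : 0 < l x₀ - u := by rw [← hk0] at hu; linarith
    -- The hyperplane is vertical. Because `C` lies in the upper half space, any positive multiple
    -- of it, tilted by `-p.2`, still bounds `C`; this `n` makes the gap at `x₀` equal to `|r| + 1 >
    -- r`.
    set n : ℝ := (|r| + 1) / (l x₀ - u) with hn
    have hn0 : 0 < n := by positivity
    refine ⟨n • l, n * u, fun p hp => ?_, ?_⟩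
    · have h1 := hf p hp
      rw [show p = (p.1, p.2) from rfl, hdec, ← hk0] at h1
      have h2 := hnonneg p hp
      have : n * l p.1 ≤ n * u := by gcongr; linarith
      simp only [FunLike.coe_smul, Pi.smul_apply, smul_eq_mul]
      linarith
    · have : n * (l x₀ - u) = |r| + 1 := by rw [hn]; field_simp
      simp only [FunLike.coe_smul, Pi.smul_apply, smul_eq_mul]
      have := le_abs_self r
      linarith
  · refine ⟨k⁻¹ • l, k⁻¹ * u, fun p hp => ?_, ?_⟩
    · have h1 := hf p hp
      rw [show p = (p.1, p.2) from rfl, hdec] at h1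
      have : k⁻¹ * (l p.1 - k * p.2) ≤ k⁻¹ * u := by gcongr
      simp only [FunLike.coe_smul, Pi.smul_apply, smul_eq_mul]
      have e : k⁻¹ * (l p.1 - k * p.2) = k⁻¹ * l p.1 - p.2 := by field_simp
      linarith
    · have : k⁻¹ * u < k⁻¹ * (l x₀ - k * r) := by gcongr
      simp only [FunLike.coe_smul, Pi.smul_apply, smul_eq_mul]
      have e : k⁻¹ * (l x₀ - k * r) = k⁻¹ * l x₀ - r := by field_simp
      linarith

end Conjugate

section Generator

/-! ### The conjugate of a superlinear generator -/

variable {φ : ℝ → EReal}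

/-- The real-valued version of `ψ*`. -/
noncomputable def legendre (φ : ℝ → EReal) (y : ℝ) : ℝ := (conj (psi φ) y).toReal

/-- The real-valued version of `θ`. -/
noncomputable def young (φ : ℝ → EReal) (y : ℝ) : ℝ := max (legendre φ y) (legendre φ (-y))

theorem IsGenerator.psi_nonneg (hφ : IsGenerator φ) {x s : ℝ} (h : psi φ x ≤ s) : 0 ≤ s := by
  exact_mod_cast (hφ.nonneg (x + 1)).trans h

theorem IsGenerator.psi_zero (hφ : IsGenerator φ) : psi φ 0 = 0 := by
  simp [psi, hφ.map_one]

theorem IsGenerator.conj_psi_nonneg (hφ : IsGenerator φ) (y : ℝ) : 0 ≤ conj (psi φ) y := by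
  have := sub_le_conj (psi φ) 0 y
  rwa [hφ.psi_zero, zero_mul, EReal.coe_zero, sub_zero] at this

theorem IsGenerator.neg_one_le (hφ : IsGenerator φ) {x s : ℝ} (h : psi φ x ≤ s) : -1 ≤ x := by
  by_contra! hx
  have := hφ.eq_top_of_neg (x + 1) (by linarith)
  rw [psi, this] at h
  exact EReal.coe_ne_top _ (top_le_iff.1 h)

/-- The effective domain of `ψ` starts at `-1`, and beyond some `X` the slope of `φ` exceeds `|y|`,
so `x * y - ψ(x)` can only be large for `x` in a bounded range. -/
theorem IsGenerator.conj_psi_ne_top (hφ : IsGenerator φ)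
    (hφ' : Tendsto (fun x : ℝ => φ x / (x : EReal)) atTop (𝓝 ⊤)) (y : ℝ) :
    conj (psi φ) y ≠ ⊤ := by
  have h1 := hφ'.eventually (lt_mem_nhds (EReal.coe_lt_top (|y| : ℝ)))
  obtain ⟨X, hX⟩ := (h1.and (Filter.eventually_gt_atTop (0 : ℝ))).exists_forall_of_atTop
  have key : conj (psi φ) y ≤ ((|X| + 1) * |y| : ℝ) := by
    rw [conj_le_coe_iff]
    intro x s hs
    have hx := hφ.neg_one_le hs
    have hs0 := hφ.psi_nonneg hs
    have hX1 := le_abs_self X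
    have hxy : x * y ≤ |x| * |y| := by rw [← abs_mul]; exact le_abs_self _
    have hy0 := abs_nonneg y
    by_cases hxX : X ≤ x + 1
    · obtain ⟨h2, h3⟩ := hX _ hxX
      have h4 : ((|y| : ℝ) : EReal) * ((x + 1 : ℝ) : EReal) ≤ φ (x + 1) :=
        (EReal.le_div_iff_mul_le (by exact_mod_cast h3) (EReal.coe_ne_top _)).1 h2.le
      have h5 : |y| * (x + 1) ≤ s := by exact_mod_cast h4.trans hs
      have h6 : |x| ≤ x + 2 := by rw [abs_le]; constructor <;> linarith
      nlinarith [abs_nonneg X]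
    · have h6 : |x| ≤ |X| + 1 := by rw [abs_le]; constructor <;> linarith [abs_nonneg X]
      nlinarith [abs_nonneg X]
  exact ne_top_of_le_ne_top (EReal.coe_ne_top _) key

variable (hφ : IsGenerator φ) (hφ' : Tendsto (fun x : ℝ => φ x / (x : EReal)) atTop (𝓝 ⊤))
include hφ hφ'

theorem coe_legendre (y : ℝ) : (legendre φ y : EReal) = conj (psi φ) y :=
  EReal.coe_toReal (hφ.conj_psi_ne_top hφ' y)
    (ne_bot_of_le_ne_bot (by simp) (hφ.conj_psi_nonneg y))

theorem legendre_le_iff {y c : ℝ} :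
    legendre φ y ≤ c ↔ ∀ x s : ℝ, psi φ x ≤ (s : EReal) → x * y - s ≤ c := by
  rw [← conj_le_coe_iff, ← coe_legendre hφ hφ', EReal.coe_le_coe_iff]

theorem mul_sub_le_legendre {x s : ℝ} (h : psi φ x ≤ (s : EReal)) (y : ℝ) :
    x * y - s ≤ legendre φ y :=
  (legendre_le_iff hφ hφ').1 le_rfl x s h

omit hφ' in
theorem legendre_nonneg (y : ℝ) : 0 ≤ legendre φ y :=
  EReal.toReal_nonneg (hφ.conj_psi_nonneg y)

theorem legendre_zero : legendre φ 0 = 0 :=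
  le_antisymm ((legendre_le_iff hφ hφ').2 fun x s h => by simpa using hφ.psi_nonneg h)
    (legendre_nonneg hφ 0)

theorem convexOn_legendre : ConvexOn ℝ Set.univ (legendre φ) := by
  refine ⟨convex_univ, fun x _ y _ a b ha hb hab => ?_⟩
  rw [legendre_le_iff hφ hφ']
  intro z s hs
  have h1 := mul_le_mul_of_nonneg_left (mul_sub_le_legendre hφ hφ' hs x) ha
  have h2 := mul_le_mul_of_nonneg_left (mul_sub_le_legendre hφ hφ' hs y) hb
  simp only [smul_eq_mul]
  have : z * (a * x + b * y) - s = a * (z * x - s) + b * (z * y - s) := by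
    linear_combination s * hab
  linarith

theorem continuous_legendre : Continuous (legendre φ) :=
  continuousOn_univ.1 ((convexOn_legendre hφ hφ').continuousOn isOpen_univ)

/-- The biconjugate theorem for `ψ`. -/
theorem psi_le_of_forall {x s : ℝ} (h : ∀ y, x * y - legendre φ y ≤ s) : psi φ x ≤ (s : EReal) := by
  set C : Set (ℝ × ℝ) := {p | psi φ p.1 ≤ (p.2 : EReal)} with hC
  have hconv : Convex ℝ C := by
    have h1 : C = (fun x => ((1 : ℝ), (0 : ℝ)) + x) ⁻¹' {p : ℝ × ℝ | φ p.1 ≤ (p.2 : EReal)} := by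
      ext p
      simp [hC, psi, add_comm]
    rw [h1]
    exact hφ.convex.translate_preimage_right ((1 : ℝ), (0 : ℝ))
  have hclosed : IsClosed C := by
    have h1 : LowerSemicontinuous (psi φ) := hφ.lsc.comp (by fun_prop)
    exact h1.isClosed_epigraph.preimage
      (f := fun p : ℝ × ℝ => (p.1, (p.2 : EReal)))
      (continuous_fst.prodMk (continuous_coe_real_ereal.comp continuous_snd))
  by_contra hx
  obtain ⟨l, c, hl, hc⟩ := exists_affine_minorant hconv hclosed
    (fun x s s' h1 h2 => le_trans h1 (EReal.coe_le_coe_iff.2 h2))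
    (by simp [hC, hφ.psi_zero]) (fun p hp => hφ.psi_nonneg hp) (x₀ := x) (r := s) hx
  have hlin : ∀ z, l z = z * l 1 := fun z => by
    have := l.map_smul z 1
    simpa using this
  have h1 : legendre φ (l 1) ≤ c := (legendre_le_iff hφ hφ').2 fun z r hz => by
    have := hl (z, r) hz
    rwa [hlin] at this
  have h2 := h (l 1)
  rw [hlin] at hc
  linarith

theorem coe_young (y : ℝ) : (young φ y : EReal) = theta φ y := by
  rw [young, theta, ← coe_legendre hφ hφ', ← coe_legendre hφ hφ']
  exact EReal.coe_strictMono.monotone.map_max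

omit hφ hφ' in
theorem young_neg (y : ℝ) : young φ (-y) = young φ y := by
  simp [young, max_comm]

theorem young_zero : young φ 0 = 0 := by
  simp [young, legendre_zero hφ hφ']

omit hφ' in
theorem young_nonneg (y : ℝ) : 0 ≤ young φ y :=
  (legendre_nonneg hφ y).trans (le_max_left _ _)

omit hφ' in
theorem young_le_add (y : ℝ) : young φ y ≤ legendre φ y + legendre φ (-y) :=
  max_le_add_of_nonneg (legendre_nonneg hφ _) (legendre_nonneg hφ _)

theorem convexOn_young : ConvexOn ℝ Set.univ (young φ) := by
  refine (convexOn_legendre hφ hφ').sup ?_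
  have := (convexOn_legendre hφ hφ').comp_linearMap (-LinearMap.id)
  simpa [Function.comp_def] using this

theorem continuous_young : Continuous (young φ) :=
  (continuous_legendre hφ hφ').max ((continuous_legendre hφ hφ').comp continuous_neg)

omit hφ hφ' in
theorem young_abs (y : ℝ) : young φ |y| = young φ y := by
  rcases abs_choice y with h | h <;> rw [h]
  exact young_neg y

/-- An even convex function that is nonnegative and vanishes at `0` is monotone in `|y|`. -/
theorem young_le_of_abs_le {x y : ℝ} (h : |x| ≤ |y|) : young φ x ≤ young φ y := by
  rw [← young_abs x, ← young_abs y]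
  have h1 := (convexOn_young hφ hφ').le_max_of_mem_Icc (Set.mem_univ 0) (Set.mem_univ |y|)
    (z := |x|) ⟨abs_nonneg x, h⟩
  rwa [young_zero hφ hφ', max_eq_right (young_nonneg hφ _)] at h1

theorem abs_mul_le_add_young {x s : ℝ} (h : psi φ x ≤ (s : EReal)) (y : ℝ) :
    |x * y| ≤ s + young φ y := by
  rw [abs_le]
  have h1 := mul_sub_le_legendre hφ hφ' h y
  have h2 := mul_sub_le_legendre hφ hφ' h (-y)
  have h3 : legendre φ y ≤ young φ y := le_max_left _ _
  have h4 : legendre φ (-y) ≤ young φ y := le_max_right _ _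
  constructor <;> linarith

/-- Finiteness of `φ` slightly to the right of `1` gives `ψ*` a supporting line of positive slope.
This linear growth puts the heart inside `L¹(ν)` and bounded functions inside the dual Orlicz space.
-/
theorem exists_young_ge : ∃ a c : ℝ, 0 < a ∧ ∀ y, a * |y| - c ≤ young φ y := by
  have h1 := hφ.finite_near_one
  rw [Metric.eventually_nhds_iff] at h1
  obtain ⟨e, he, h⟩ := h1
  have hpos : φ (1 + e / 2) < ⊤ := h (by simp [abs_of_pos he]; linarith)
  have hfin : psi φ (e / 2) ≤ ((φ (1 + e / 2)).toReal : EReal) := by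
    rw [psi, add_comm]
    exact EReal.le_coe_toReal hpos.ne
  refine ⟨e / 2, (φ (1 + e / 2)).toReal, by positivity, fun y => ?_⟩
  have := mul_sub_le_legendre hφ hφ' hfin |y|
  rw [← young_abs]
  exact this.trans (le_max_left _ _)

end Generator

section Interchange

/-! ### Interchange of supremum and integral -/

variable {Ω : Type*} [MeasurableSpace Ω] {ν : Measure Ω} [IsFiniteMeasure ν]

omit [IsFiniteMeasure ν] in
theorem integrable_simpleFunc_mul {h : Ω → ℝ} (hh : Integrable h ν) (s : SimpleFunc Ω ℝ) :
    Integrable (fun ω => s ω * h ω) ν := by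
  obtain ⟨C, hC⟩ := s.exists_forall_norm_le
  exact hh.bdd_mul (c := C) s.aestronglyMeasurable (ae_of_all _ hC)

/-- Among the first affine functions of a sequence, a measurable choice of a maximal one. -/
theorem exists_simpleFunc_argmax {v : ℕ → Ω → ℝ} (hv : ∀ n, Measurable (v n)) :
    ∃ N : ℕ → SimpleFunc Ω ℕ, Monotone (fun n ω => v (N n ω) ω) ∧
      ∀ n ω, ∀ i ≤ n, v i ω ≤ v (N n ω) ω := by
  have hmeas : ∀ N : SimpleFunc Ω ℕ, Measurable fun ω => v (N ω) ω := fun N =>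
    N.measurable_bind (fun n ω => v n ω) hv
  let step : ℕ → SimpleFunc Ω ℕ → SimpleFunc Ω ℕ := fun n M =>
    SimpleFunc.piecewise {ω | v (M ω) ω < v (n + 1) ω}
      (measurableSet_lt (hmeas M) (hv (n + 1))) (SimpleFunc.const Ω (n + 1)) M
  let N : ℕ → SimpleFunc Ω ℕ := fun n => Nat.rec (SimpleFunc.const Ω 0) step n
  have hstep : ∀ n ω, N (n + 1) ω = if v (N n ω) ω < v (n + 1) ω then n + 1 else N n ω := by
    intro n ω
    change step n (N n) ω = _
    simp only [step, SimpleFunc.coe_piecewise, Set.piecewise, Set.mem_ofPred_eq,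
      SimpleFunc.const_apply]
  have hmono : Monotone fun n ω => v (N n ω) ω := by
    refine monotone_nat_of_le_succ fun n ω => ?_
    simp only [hstep]
    split_ifs with h
    · exact h.le
    · exact le_rfl
  refine ⟨N, hmono, fun n ω => ?_⟩
  induction n with
  | zero =>
    intro i hi
    obtain rfl : i = 0 := by omega
    exact le_rfl
  | succ n ih =>
    intro i hi
    rcases Nat.lt_or_ge i (n + 1) with h | h
    · exact (ih i (by omega)).trans (hmono n.le_succ ω)
    · obtain rfl : i = n + 1 := le_antisymm hi h
      rw [hstep]
      split_ifs with h'
      · exact le_rfl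
      · exact not_lt.1 h'

/-- The running maxima are realised by simple index functions, to which `H` applies, and increase to
the supremum, so monotone convergence concludes. The zero entry at index `0` keeps every maximum
nonnegative. -/
theorem lintegral_iSup_affine_le {h : Ω → ℝ} (hm : Measurable h) (hh : Integrable h ν)
    {x r : ℕ → ℝ} (hx : x 0 = 0) (hr : r 0 = 0) {c : ℝ}
    (H : ∀ N : SimpleFunc Ω ℕ, ∫ ω, (x (N ω) * h ω - r (N ω)) ∂ν ≤ c) :
    ∫⁻ ω, ⨆ i, ENNReal.ofReal (x i * h ω - r i) ∂ν ≤ ENNReal.ofReal c := by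
  obtain ⟨N, hmono, hmax⟩ := exists_simpleFunc_argmax
    (v := fun i ω => x i * h ω - r i) (fun n => (hm.const_mul _).sub_const _)
  have hnn : ∀ n ω, 0 ≤ x (N n ω) * h ω - r (N n ω) := fun n ω => by
    simpa [hx, hr] using hmax n ω 0 (Nat.zero_le n)
  have hint : ∀ n, Integrable (fun ω => x (N n ω) * h ω - r (N n ω)) ν := fun n =>
    (integrable_simpleFunc_mul hh ((N n).map x)).sub
      ((N n).map r).integrable_of_isFiniteMeasure
  have hmeas : ∀ n, Measurable fun ω => ENNReal.ofReal (x (N n ω) * h ω - r (N n ω)) := fun n =>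
    ((((N n).map x).measurable.mul hm).sub ((N n).map r).measurable).ennreal_ofReal
  calc ∫⁻ ω, ⨆ i, ENNReal.ofReal (x i * h ω - r i) ∂ν
      ≤ ∫⁻ ω, ⨆ n, ENNReal.ofReal (x (N n ω) * h ω - r (N n ω)) ∂ν := by
        refine lintegral_mono fun ω => iSup_mono fun i => ?_
        exact ENNReal.ofReal_le_ofReal (hmax i ω i le_rfl)
    _ = ⨆ n, ∫⁻ ω, ENNReal.ofReal (x (N n ω) * h ω - r (N n ω)) ∂ν :=
        lintegral_iSup hmeas fun m n hmn ω => ENNReal.ofReal_le_ofReal (hmono hmn ω)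
    _ ≤ ENNReal.ofReal c := by
        refine iSup_le fun n => ?_
        rw [← ofReal_integral_eq_lintegral_ofReal (hint n) (ae_of_all _ (hnn n))]
        exact ENNReal.ofReal_le_ofReal (H (N n))

/-- The support function of a planar set is a countable supremum. -/
theorem exists_seq_affine_dense {C : Set (ℝ × ℝ)} (h0 : (0, 0) ∈ C) :
    ∃ x r : ℕ → ℝ, x 0 = 0 ∧ r 0 = 0 ∧ (∀ i, (x i, r i) ∈ C) ∧
      ∀ y c : ℝ, (∀ i, x i * y - r i ≤ c) → ∀ p ∈ C, p.1 * y - p.2 ≤ c := by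
  have : Nonempty C := ⟨⟨_, h0⟩⟩
  let d := TopologicalSpace.denseSeq C
  -- The origin is prepended to a dense sequence, so the dense points sit at indices `n + 1`.
  let e : ℕ → C := fun n => Nat.casesOn n ⟨_, h0⟩ d
  refine ⟨fun i => (e i).1.1, fun i => (e i).1.2, rfl, rfl, fun i => (e i).2, fun y c h p hp => ?_⟩
  have hcl : IsClosed {q : C | q.1.1 * y - q.1.2 ≤ c} := isClosed_le (by fun_prop) (by fun_prop)
  have hsub : Set.range d ⊆ {q : C | q.1.1 * y - q.1.2 ≤ c} := by
    rintro _ ⟨n, rfl⟩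
    exact h (n + 1)
  have huniv := (TopologicalSpace.denseRange_denseSeq C).closure_eq ▸
    hcl.closure_subset_iff.2 hsub
  exact huniv (Set.mem_univ (⟨p, hp⟩ : C))

variable {φ : ℝ → EReal} (hφ : IsGenerator φ)
  (hφ' : Tendsto (fun x : ℝ => φ x / (x : EReal)) atTop (𝓝 ⊤))
include hφ hφ'

/-- `ψ*` is a countable supremum of affine functions indexed by epigraph points of `ψ`, so simple
selections `(u, s)` from that epigraph already test the integral. -/
theorem lintegral_legendre_le {h : Ω → ℝ} (hm : Measurable h) (hh : Integrable h ν) {c : ℝ}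
    (H : ∀ u s : SimpleFunc Ω ℝ, (∀ ω, psi φ (u ω) ≤ (s ω : EReal)) →
      ∫ ω, (u ω * h ω - s ω) ∂ν ≤ c) :
    ∫⁻ ω, ENNReal.ofReal (legendre φ (h ω)) ∂ν ≤ ENNReal.ofReal c := by
  obtain ⟨x, r, hx, hr, hmem, hdense⟩ := exists_seq_affine_dense
    (C := {p | psi φ p.1 ≤ (p.2 : EReal)}) (by simp [hφ.psi_zero])
  refine le_trans (lintegral_mono fun ω => ?_)
    (lintegral_iSup_affine_le hm hh hx hr fun N => H (N.map x) (N.map r) fun ω => hmem (N ω))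
  set S := ⨆ i, ENNReal.ofReal (x i * h ω - r i) with hS
  by_cases hT : S = ⊤
  · rw [hT]; exact le_top
  rw [← ENNReal.ofReal_toReal hT]
  refine ENNReal.ofReal_le_ofReal ((legendre_le_iff hφ hφ').2 fun a b hab => ?_)
  refine hdense _ _ (fun i => ?_) (a, b) hab
  exact (ENNReal.ofReal_le_iff_le_toReal hT).1
    (le_iSup (fun i => ENNReal.ofReal (x i * h ω - r i)) i)

/-- The mirror image, with the roles of `ψ` and `ψ*` exchanged through the biconjugate theorem. It
gives weak lower semicontinuity, since only simple test functions `h` occur. -/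
theorem lintegral_psi_le {u : Ω → ℝ} (hm : Measurable u) (hu : Integrable u ν) {c : ℝ}
    (H : ∀ h s : SimpleFunc Ω ℝ, (∀ ω, legendre φ (h ω) ≤ s ω) →
      ∫ ω, (h ω * u ω - s ω) ∂ν ≤ c) :
    ∫⁻ ω, (psi φ (u ω)).toENNReal ∂ν ≤ ENNReal.ofReal c := by
  obtain ⟨x, r, hx, hr, hmem, hdense⟩ := exists_seq_affine_dense
    (C := {p | legendre φ p.1 ≤ p.2}) (legendre_zero hφ hφ').le
  refine le_trans (lintegral_mono fun ω => ?_)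
    (lintegral_iSup_affine_le hm hu hx hr fun N => H (N.map x) (N.map r) fun ω => hmem (N ω))
  set S := ⨆ i, ENNReal.ofReal (x i * u ω - r i) with hS
  by_cases hT : S = ⊤
  · rw [hT]; exact le_top
  rw [← ENNReal.ofReal_toReal hT]
  refine EReal.toENNReal_le_toENNReal (psi_le_of_forall hφ hφ' fun y => ?_)
  rw [mul_comm]
  refine hdense _ _ (fun i => ?_) (y, _) (le_refl (legendre φ y))
  exact (ENNReal.ofReal_le_iff_le_toReal hT).1
    (le_iSup (fun i => ENNReal.ofReal (x i * u ω - r i)) i)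

end Interchange

section Orlicz

/-! ### Orlicz spaces and the Young inequality -/

variable {Ω : Type*} [MeasurableSpace Ω] {ν : Measure Ω} {φ : ℝ → EReal}

/-- The functions all of whose multiples have an integrable Young modular. -/
def HeartFun (φ : ℝ → EReal) (ν : Measure Ω) (h : Ω → ℝ) : Prop :=
  AEStronglyMeasurable h ν ∧ ∀ a : ℝ, Integrable (fun ω => young φ (a * h ω)) ν

theorem IsGenerator.coe_psi_nonneg (hφ : IsGenerator φ) (x : ℝ) : 0 ≤ psi φ x := hφ.nonneg _

theorem _root_.ConvexOn.map_add_div_two_le {F : ℝ → ℝ} (hF : ConvexOn ℝ Set.univ F) (x y : ℝ) :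
    F ((x + y) / 2) ≤ (F x + F y) / 2 := by
  have h := hF.2 (Set.mem_univ x) (Set.mem_univ y)
    (show (0 : ℝ) ≤ 1 / 2 by norm_num) (show (0 : ℝ) ≤ 1 / 2 by norm_num) (by norm_num)
  simp only [smul_eq_mul] at h
  rw [show 1 / 2 * x + 1 / 2 * y = (x + y) / 2 by ring] at h
  linarith

theorem intFun_coe {F : ℝ → ℝ} {f : ℝ → EReal} (hF : ∀ x, (F x : EReal) = f x) (h : Ω → ℝ) :
    intFun f ν h = ∫⁻ ω, ENNReal.ofReal (F (h ω)) ∂ν := by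
  simp only [intFun, ← hF, EReal.real_coe_toENNReal]

theorem intFun_eq_lintegral_psi (f : Ω → ℝ) :
    intFun φ ν f = ∫⁻ ω, (psi φ (f ω - 1)).toENNReal ∂ν := by
  simp only [intFun, psi, sub_add_cancel]

theorem integrable_of_lintegral_ofReal_lt_top {F : Ω → ℝ} (hF : AEStronglyMeasurable F ν)
    (h0 : ∀ ω, 0 ≤ F ω) (h : ∫⁻ ω, ENNReal.ofReal (F ω) ∂ν < ⊤) : Integrable F ν :=
  ⟨hF, by rwa [hasFiniteIntegral_iff_ofReal (ae_of_all _ h0)]⟩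

theorem IsGenerator.measurable_psi (hφ : IsGenerator φ) : Measurable (psi φ) :=
  hφ.lsc.measurable.comp (measurable_add_const 1)

variable (hφ : IsGenerator φ) (hφ' : Tendsto (fun x : ℝ => φ x / (x : EReal)) atTop (𝓝 ⊤))
include hφ hφ'

theorem HeartFun.mono {g h : Ω → ℝ} (hh : HeartFun φ ν h) (hg : AEStronglyMeasurable g ν)
    (hgh : ∀ ω, |g ω| ≤ |h ω|) : HeartFun φ ν g := by
  refine ⟨hg, fun a => (hh.2 a).mono'
    ((continuous_young hφ hφ').comp_aestronglyMeasurable (hg.const_mul a))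
    (ae_of_all _ fun ω => ?_)⟩
  rw [Real.norm_eq_abs, abs_of_nonneg (young_nonneg hφ _)]
  refine young_le_of_abs_le hφ hφ' ?_
  rw [abs_mul, abs_mul]
  exact mul_le_mul_of_nonneg_left (hgh ω) (abs_nonneg a)

omit hφ hφ' in
theorem HeartFun.const_mul {h : Ω → ℝ} (hh : HeartFun φ ν h) (b : ℝ) :
    HeartFun φ ν (fun ω => b * h ω) :=
  ⟨hh.1.const_mul b, fun a => by simpa only [mul_assoc] using hh.2 (a * b)⟩

theorem HeartFun.add {g h : Ω → ℝ} (hg : HeartFun φ ν g) (hh : HeartFun φ ν h) :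
    HeartFun φ ν (fun ω => g ω + h ω) := by
  refine ⟨hg.1.add hh.1, fun a => ((hg.2 (2 * a)).add (hh.2 (2 * a))).mono'
    ((continuous_young hφ hφ').comp_aestronglyMeasurable ((hg.1.add hh.1).const_mul a))
    (ae_of_all _ fun ω => ?_)⟩
  rw [Real.norm_eq_abs, abs_of_nonneg (young_nonneg hφ _)]
  have h1 := (convexOn_young hφ hφ').map_add_div_two_le (2 * a * g ω) (2 * a * h ω)
  have h2 : (2 * a * g ω + 2 * a * h ω) / 2 = a * (g ω + h ω) := by ring
  rw [h2] at h1
  have h3 := young_nonneg hφ (2 * a * g ω)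
  have h4 := young_nonneg hφ (2 * a * h ω)
  change _ ≤ young φ (2 * a * g ω) + young φ (2 * a * h ω)
  linarith

omit hφ hφ' in
theorem heartFun_const [IsFiniteMeasure ν] (c : ℝ) : HeartFun φ ν (fun _ => c) :=
  ⟨aestronglyMeasurable_const, fun _ => integrable_const _⟩

theorem heartFun_of_bounded [IsFiniteMeasure ν] {h : Ω → ℝ} (hm : AEStronglyMeasurable h ν)
    {c : ℝ} (hc : ∀ ω, |h ω| ≤ c) : HeartFun φ ν h :=
  (heartFun_const c).mono hφ hφ' hm fun ω => (hc ω).trans (le_abs_self c)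

theorem heartFun_simpleFunc [IsFiniteMeasure ν] (s : SimpleFunc Ω ℝ) : HeartFun φ ν s := by
  obtain ⟨c, hc⟩ := s.exists_forall_norm_le
  exact heartFun_of_bounded hφ hφ' s.aestronglyMeasurable hc

theorem HeartFun.integrable_legendre {h : Ω → ℝ} (hh : HeartFun φ ν h) :
    Integrable (fun ω => legendre φ (h ω)) ν := by
  refine (hh.2 1).mono' ((continuous_legendre hφ hφ').comp_aestronglyMeasurable hh.1)
    (ae_of_all _ fun ω => ?_)
  rw [Real.norm_eq_abs, abs_of_nonneg (legendre_nonneg hφ _), one_mul]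
  exact le_max_left _ _

theorem heartFun_of_integrable_legendre {h : Ω → ℝ} (hm : AEStronglyMeasurable h ν)
    (H : ∀ a : ℝ, Integrable (fun ω => legendre φ (a * h ω)) ν) : HeartFun φ ν h := by
  refine ⟨hm, fun a => ((H a).add (H (-a))).mono'
    ((continuous_young hφ hφ').comp_aestronglyMeasurable (hm.const_mul a))
    (ae_of_all _ fun ω => ?_)⟩
  rw [Real.norm_eq_abs, abs_of_nonneg (young_nonneg hφ _)]
  refine (young_le_add hφ _).trans_eq ?_
  simp [neg_mul]

theorem HeartFun.integrable [IsFiniteMeasure ν] {h : Ω → ℝ} (hh : HeartFun φ ν h) :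
    Integrable h ν := by
  obtain ⟨a, c, ha, hac⟩ := exists_young_ge hφ hφ'
  refine (((hh.2 1).add (integrable_const c)).const_mul a⁻¹).mono' hh.1
    (ae_of_all _ fun ω => ?_)
  have h1 := hac (1 * h ω)
  rw [Real.norm_eq_abs, ← div_eq_inv_mul, le_div_iff₀ ha]
  simp only [Pi.add_apply]
  rw [one_mul] at h1 ⊢
  linarith

theorem mem_orliczHeart_iff {g : Ω →ₘ[ν] ℝ} :
    g ∈ orliczHeart (theta φ) ν ↔ HeartFun φ ν g := by
  have hmeas : ∀ a : ℝ, AEStronglyMeasurable (fun ω => young φ (a * g ω)) ν := fun a =>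
    (continuous_young hφ hφ').comp_aestronglyMeasurable (g.aestronglyMeasurable.const_mul a)
  constructor
  · intro h
    have hpos : ∀ a : ℝ, 0 < a → Integrable (fun ω => young φ (a * g ω)) ν := fun a ha => by
      have := h a ha
      rw [intFun_coe (coe_young hφ hφ')] at this
      exact integrable_of_lintegral_ofReal_lt_top (hmeas a) (fun ω => young_nonneg hφ _) this
    refine ⟨g.aestronglyMeasurable, fun a => ?_⟩
    rcases lt_trichotomy a 0 with ha | rfl | ha
    · refine (hpos (-a) (neg_pos.2 ha)).congr (ae_of_all _ fun ω => ?_)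
      simp only [neg_mul, young_neg]
    · simp [young_zero hφ hφ']
    · exact hpos a ha
  · intro h a _
    rw [intFun_coe (coe_young hφ hφ')]
    exact ((hasFiniteIntegral_iff_ofReal (ae_of_all _ fun ω => young_nonneg hφ _)).1
      (h.2 a).hasFiniteIntegral)

omit hφ in
theorem slopeAt_atTop : slopeAt φ atTop = ⊤ := hφ'.limUnder_eq

theorem cgf_eq (g : Ω →ₘ[ν] ℝ) (t : ℝ) :
    cgf φ ν g t =
      ⨅ lam : ℝ, ((∫⁻ ω, ENNReal.ofReal (legendre φ (t * g ω + lam)) ∂ν : ℝ≥0∞) : EReal) := by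
  simp only [cgf, slopeAt_atTop hφ', le_top, iInf_pos,
    intFun_coe (coe_legendre hφ hφ')]

/-- The shift is harmless: `a * g` is the midpoint of `2 * a * g + lam` and the constant `-lam`, so
convexity bounds `ψ*(a g)` by an integrable function. Using both signs of `a` passes from `ψ*` to
`θ`. -/
theorem mem_stronglySubexp_iff [IsFiniteMeasure ν] {g : Ω →ₘ[ν] ℝ} :
    g ∈ stronglySubexp φ ν ↔ HeartFun φ ν g := by
  constructor
  · intro h
    refine heartFun_of_integrable_legendre hφ hφ' g.aestronglyMeasurable fun a => ?_
    have h1 := h (2 * a)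
    rw [cgf_eq hφ hφ', iInf_lt_iff] at h1
    obtain ⟨lam, h1⟩ := h1
    have hm : AEStronglyMeasurable (fun ω => legendre φ (2 * a * g ω + lam)) ν :=
      (continuous_legendre hφ hφ').comp_aestronglyMeasurable
        ((g.aestronglyMeasurable.const_mul _).add aestronglyMeasurable_const)
    have h2 : Integrable (fun ω => legendre φ (2 * a * g ω + lam)) ν :=
      integrable_of_lintegral_ofReal_lt_top hm (fun ω => legendre_nonneg hφ _)
        (by simpa [lt_top_iff_ne_top] using h1)
    refine (h2.add (integrable_const (legendre φ (-lam)))).mono'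
      ((continuous_legendre hφ hφ').comp_aestronglyMeasurable
        (g.aestronglyMeasurable.const_mul a)) (ae_of_all _ fun ω => ?_)
    rw [Real.norm_eq_abs, abs_of_nonneg (legendre_nonneg hφ _)]
    have h3 := (convexOn_legendre hφ hφ').map_add_div_two_le (2 * a * g ω + lam) (-lam)
    have h4 : (2 * a * g ω + lam + -lam) / 2 = a * g ω := by ring
    rw [h4] at h3
    have h5 := legendre_nonneg hφ (2 * a * g ω + lam)
    have h6 := legendre_nonneg hφ (-lam)
    change _ ≤ legendre φ (2 * a * g ω + lam) + legendre φ (-lam)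
    linarith
  · intro h t
    rw [cgf_eq hφ hφ', iInf_lt_iff]
    refine ⟨0, ?_⟩
    have h1 := (h.const_mul t).integrable_legendre hφ hφ'
    have h2 := (hasFiniteIntegral_iff_ofReal (ae_of_all _ fun ω => legendre_nonneg hφ _)).1
      h1.hasFiniteIntegral
    simpa [lt_top_iff_ne_top] using h2

/-- The integrated Young inequality. -/
theorem integral_mul_le {u h : Ω → ℝ} (hu : AEStronglyMeasurable u ν) {T : ℝ} (hT : 0 ≤ T)
    (huT : ∫⁻ ω, (psi φ (u ω)).toENNReal ∂ν ≤ ENNReal.ofReal T) (hh : HeartFun φ ν h) :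
    Integrable (fun ω => u ω * h ω) ν ∧
      |∫ ω, u ω * h ω ∂ν| ≤ T + ∫ ω, young φ (h ω) ∂ν ∧
      ∫ ω, u ω * h ω ∂ν ≤ T + ∫ ω, legendre φ (h ω) ∂ν := by
  have hmeas : AEMeasurable (fun ω => (psi φ (u ω)).toENNReal) ν :=
    (hφ.measurable_psi.comp_aemeasurable hu.aemeasurable).ereal_toENNReal
  have hne : ∫⁻ ω, (psi φ (u ω)).toENNReal ∂ν ≠ ⊤ :=
    ne_top_of_le_ne_top ENNReal.ofReal_ne_top huT
  have hR := integrable_toReal_of_lintegral_ne_top hmeas hne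
  have hRT : ∫ ω, (psi φ (u ω)).toENNReal.toReal ∂ν ≤ T := by
    rw [integral_toReal hmeas (ae_lt_top' hmeas hne)]
    exact ENNReal.toReal_le_of_le_ofReal hT huT
  have hpsi : ∀ᵐ ω ∂ν, psi φ (u ω) ≤ ((psi φ (u ω)).toENNReal.toReal : EReal) := by
    filter_upwards [ae_lt_top' hmeas hne] with ω hω
    rw [EReal.toReal_toENNReal (hφ.coe_psi_nonneg _)]
    exact EReal.le_coe_toReal (EReal.toENNReal_ne_top_iff.1 hω.ne)
  have hy := hh.2 1
  simp only [one_mul] at hy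
  have habs : ∀ᵐ ω ∂ν, ‖u ω * h ω‖ ≤ (psi φ (u ω)).toENNReal.toReal + young φ (h ω) := by
    filter_upwards [hpsi] with ω hω
    exact abs_mul_le_add_young hφ hφ' hω (h ω)
  have hint : Integrable (fun ω => u ω * h ω) ν :=
    (hR.add hy).mono' (hu.mul hh.1) habs
  refine ⟨hint, ?_, ?_⟩
  · refine (norm_integral_le_of_norm_le (hR.add hy) habs).trans ?_
    simp only [Pi.add_apply]
    rw [integral_add hR hy]
    linarith
  · have hl := hh.integrable_legendre hφ hφ'
    have h1 : ∫ ω, u ω * h ω ∂ν ≤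
        ∫ ω, ((psi φ (u ω)).toENNReal.toReal + legendre φ (h ω)) ∂ν := by
      refine integral_mono_ae hint (hR.add hl) ?_
      filter_upwards [hpsi] with ω hω
      have := mul_sub_le_legendre hφ hφ' hω (h ω)
      linarith
    rw [integral_add hR hl] at h1
    linarith

/-! ### The Orlicz space of `θ*` and its pairing with the heart. -/

theorem conj_theta_le_iff {y c : ℝ} :
    conj (theta φ) y ≤ (c : EReal) ↔ ∀ x : ℝ, x * y - young φ x ≤ c := by
  rw [conj_le_coe_iff]
  refine forall_congr' fun x => ⟨fun h => h _ (coe_young hφ hφ' x).ge, fun h s hs => ?_⟩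
  rw [← coe_young hφ hφ', EReal.coe_le_coe_iff] at hs
  linarith

theorem abs_mul_le_of_conj_theta_le {y s : ℝ} (h : conj (theta φ) y ≤ (s : EReal)) (x : ℝ) :
    |y * x| ≤ s + young φ x := by
  rw [conj_theta_le_iff hφ hφ'] at h
  have h1 := h x
  have h2 := h (-x)
  rw [young_neg] at h2
  rw [abs_le]
  constructor <;> linarith

theorem conj_theta_nonneg (y : ℝ) : 0 ≤ conj (theta φ) y := by
  have := sub_le_conj (theta φ) 0 y
  rwa [← coe_young hφ hφ', young_zero hφ hφ', zero_mul, EReal.coe_zero, sub_zero] at this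

theorem integrable_mul_of_mem_orliczSpace {f : Ω →ₘ[ν] ℝ}
    (hf : f ∈ orliczSpace (conj (theta φ)) ν) {g : Ω → ℝ} (hg : HeartFun φ ν g) :
    Integrable (fun ω => f ω * g ω) ν := by
  obtain ⟨a, ha, hfin⟩ := hf
  have hmeas : AEMeasurable (fun ω => (conj (theta φ) (a * f ω)).toENNReal) ν :=
    ((lowerSemicontinuous_conj (theta φ)).measurable.comp_aemeasurable
      (f.aestronglyMeasurable.const_mul a).aemeasurable).ereal_toENNReal
  have hR := integrable_toReal_of_lintegral_ne_top hmeas hfin.ne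
  have hy := hg.2 1
  simp only [one_mul] at hy
  refine ((hR.add hy).const_mul a⁻¹).mono' (f.aestronglyMeasurable.mul hg.1) ?_
  filter_upwards [ae_lt_top' hmeas hfin.ne] with ω hω
  have h1 : conj (theta φ) (a * f ω) ≤ ((conj (theta φ) (a * f ω)).toENNReal.toReal : EReal) := by
    rw [EReal.toReal_toENNReal (conj_theta_nonneg hφ hφ' _)]
    exact EReal.le_coe_toReal (EReal.toENNReal_ne_top_iff.1 hω.ne)
  have h2 := abs_mul_le_of_conj_theta_le hφ hφ' h1 (g ω)
  rw [mul_assoc, abs_mul, abs_of_pos ha] at h2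
  rw [Real.norm_eq_abs, ← div_eq_inv_mul, le_div_iff₀ ha]
  simp only [Pi.add_apply]
  linarith

theorem mem_orliczSpace_of_intFun_ne_top [IsFiniteMeasure ν] {f : Ω →ₘ[ν] ℝ}
    (hf : intFun φ ν f ≠ ⊤) : f ∈ orliczSpace (conj (theta φ)) ν := by
  -- The target is `θ*(b z) ≤ ψ(z - 1) + c`. Split `b z y` into `b (z - 1) y` and `b y`: with `b ≤
  -- 1/2` the first costs half of `θ(y)` by Young, and with `b ≤ a/2` the second costs `(θ(y) + c) /
  -- 2` by linear growth.
  obtain ⟨a, c, ha, hac⟩ := exists_young_ge hφ hφ'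
  have hc0 : 0 ≤ c := by
    have := hac 0
    rw [young_zero hφ hφ', abs_zero] at this
    linarith
  set b := min (1 / 2) (a / 2) with hb
  have hb0 : 0 < b := lt_min (by norm_num) (by positivity)
  have hb1 : b ≤ 1 / 2 := min_le_left _ _
  have hb2 : b ≤ a / 2 := min_le_right _ _
  refine ⟨b, hb0, ?_⟩
  have key : ∀ z s : ℝ, psi φ (z - 1) ≤ (s : EReal) →
      conj (theta φ) (b * z) ≤ ((s + c : ℝ) : EReal) := by
    intro z s hs
    rw [conj_theta_le_iff hφ hφ']
    intro y
    have hs0 := hφ.psi_nonneg hs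
    have h1 := (le_abs_self _).trans (abs_mul_le_add_young hφ hφ' hs y)
    have h2 := hac y
    have h3 := young_nonneg hφ y
    have h4 : b * ((z - 1) * y) ≤ b * (s + young φ y) := by gcongr
    have h5 : b * (s + young φ y) ≤ 1 / 2 * (s + young φ y) := by gcongr
    have h6 : b * y ≤ a / 2 * |y| :=
      (mul_le_mul_of_nonneg_left (le_abs_self y) hb0.le).trans
        (mul_le_mul_of_nonneg_right hb2 (abs_nonneg y))
    have h7 : y * (b * z) = b * ((z - 1) * y) + b * y := by ring
    linarith
  have hpt : ∀ ω, (conj (theta φ) (b * f ω)).toENNReal ≤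
      (psi φ (f ω - 1)).toENNReal + ENNReal.ofReal c := by
    intro ω
    by_cases hT : psi φ (f ω - 1) = ⊤
    · simp [hT]
    · have h1 := EReal.toENNReal_le_toENNReal
        (key (f ω) _ (EReal.le_coe_toReal hT))
      rwa [EReal.real_coe_toENNReal,
        ENNReal.ofReal_add (EReal.toReal_nonneg (hφ.coe_psi_nonneg _)) hc0,
        ← EReal.toENNReal_of_ne_top hT] at h1
  refine (lintegral_mono hpt).trans_lt ?_
  rw [lintegral_add_right _ measurable_const, ← intFun_eq_lintegral_psi]
  exact ENNReal.add_lt_top.2 ⟨hf.lt_top, by simp [ENNReal.mul_lt_top_iff]⟩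

theorem mem_orliczSpace_of_bounded [IsFiniteMeasure ν] {f : Ω →ₘ[ν] ℝ}
    (hf : ∀ᵐ ω ∂ν, |f ω| ≤ 1) : f ∈ orliczSpace (conj (theta φ)) ν := by
  obtain ⟨a, c, ha, hac⟩ := exists_young_ge hφ hφ'
  refine ⟨a, ha, ?_⟩
  have hpt : ∀ᵐ ω ∂ν, (conj (theta φ) (a * f ω)).toENNReal ≤ ENNReal.ofReal c := by
    filter_upwards [hf] with ω hω
    refine EReal.toENNReal_le_toENNReal ((conj_theta_le_iff hφ hφ').2 fun x => ?_)
    have h1 := hac x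
    have h2 : x * f ω ≤ |x| * 1 := (le_abs_self _).trans
      (by rw [abs_mul]; exact mul_le_mul_of_nonneg_left hω (abs_nonneg x))
    have h3 : x * (a * f ω) = a * (x * f ω) := by ring
    have h4 := mul_le_mul_of_nonneg_left h2 ha.le
    rw [mul_one] at h4
    linarith
  refine (lintegral_mono_ae hpt).trans_lt ?_
  simp [ENNReal.mul_lt_top_iff]

/-- The sign of a function is bounded, hence belongs to both spaces; pairing a function with its own
sign gives its `L¹` norm. -/
theorem separatingPairing [IsFiniteMeasure ν] :
    SeparatingPairing ν (orliczSpace (conj (theta φ)) ν) (stronglySubexp φ ν) := by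
  have hsign : ∀ f : Ω →ₘ[ν] ℝ, ∃ s : Ω →ₘ[ν] ℝ, (∀ᵐ ω ∂ν, s ω = SignType.sign (f ω)) := by
    intro f
    have hm : Measurable fun ω => ((SignType.sign (f ω) : SignType) : ℝ) := by
      have h1 : Measurable fun x : ℝ => ((SignType.sign x : SignType) : ℝ) := by
        have : (fun x : ℝ => ((SignType.sign x : SignType) : ℝ)) =
            fun x => if 0 < x then 1 else if x < 0 then -1 else 0 := by
          ext x
          simp only [sign_apply]
          split_ifs <;> simp
        rw [this]
        exact Measurable.ite measurableSet_Ioi measurable_const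
          (Measurable.ite measurableSet_Iio measurable_const measurable_const)
      exact h1.comp f.measurable
    exact ⟨AEEqFun.mk _ hm.aestronglyMeasurable, AEEqFun.coeFn_mk _ _⟩
  have habs : ∀ x : ℝ, |((SignType.sign x : SignType) : ℝ)| ≤ 1 := fun x => by
    rcases SignType.sign x <;> simp
  have hzero : ∀ f : Ω →ₘ[ν] ℝ, Integrable f ν → ∫ ω, |f ω| ∂ν = 0 → f = 0 := by
    intro f hf h
    rw [integral_eq_zero_iff_of_nonneg (fun ω => abs_nonneg _) hf.abs] at h
    refine AEEqFun.ext ?_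
    filter_upwards [h, AEEqFun.coeFn_zero (α := Ω) (β := ℝ) (μ := ν)] with ω h1 h2
    rw [h2]
    exact abs_eq_zero.1 h1
  refine ⟨fun f hf g hg => integrable_mul_of_mem_orliczSpace hφ hφ' hf
    ((mem_stronglySubexp_iff hφ hφ').1 hg), fun f hf h => ?_, fun g hg h => ?_⟩
  · have hfi : Integrable f ν := by
      simpa using integrable_mul_of_mem_orliczSpace hφ hφ' hf (heartFun_const 1)
    obtain ⟨s, hs⟩ := hsign f
    have hsS : s ∈ stronglySubexp φ ν := by
      rw [mem_stronglySubexp_iff hφ hφ']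
      refine ⟨s.aestronglyMeasurable, fun a => ?_⟩
      refine (integrable_const (young φ a)).mono'
        ((continuous_young hφ hφ').comp_aestronglyMeasurable
          (s.aestronglyMeasurable.const_mul a)) ?_
      filter_upwards [hs] with ω hω
      rw [Real.norm_eq_abs, abs_of_nonneg (young_nonneg hφ _)]
      refine young_le_of_abs_le hφ hφ' ?_
      rw [abs_mul, hω]
      exact mul_le_of_le_one_right (abs_nonneg a) (habs _)
    refine hzero f hfi ?_
    rw [← h s hsS]
    refine integral_congr_ae ?_
    filter_upwards [hs] with ω hω
    rw [hω, mul_comm, sign_mul_self]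
  · rw [mem_stronglySubexp_iff hφ hφ'] at hg
    obtain ⟨s, hs⟩ := hsign g
    have hsX : s ∈ orliczSpace (conj (theta φ)) ν := by
      refine mem_orliczSpace_of_bounded hφ hφ' ?_
      filter_upwards [hs] with ω hω
      rw [hω]
      exact habs _
    refine hzero g (hg.integrable hφ hφ') ?_
    rw [← h s hsX]
    refine integral_congr_ae ?_
    filter_upwards [hs] with ω hω
    rw [hω, sign_mul_self]

end Orlicz

section Compactness

/-! ### Weak compactness of the sublevel sets -/

variable {Ω : Type*} [MeasurableSpace Ω] {ν : Measure Ω} [IsFiniteMeasure ν]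

/-- A uniformly absolutely continuous additive set function is a signed measure. -/
theorem exists_signedMeasure {m : Set Ω → ℝ}
    (hadd : ∀ A B, MeasurableSet A → MeasurableSet B → Disjoint A B → m (A ∪ B) = m A + m B)
    (hcont : ∀ e : ℝ, 0 < e → ∃ d : ℝ, 0 < d ∧ ∀ A, MeasurableSet A → ν.real A < d → |m A| < e) :
    ∃ μ : SignedMeasure Ω, μ.AbsolutelyContinuous ν.toENNRealVectorMeasure ∧
      ∀ A, MeasurableSet A → μ A = m A := by
  classical
  have hempty : m ∅ = 0 := by
    have := hadd ∅ ∅ .empty .empty disjoint_bot_left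
    rw [Set.union_empty] at this
    linarith
  have hfin : ∀ (f : ℕ → Set Ω), (∀ i, MeasurableSet (f i)) → Pairwise (Function.onFun Disjoint f) →
      ∀ s : Finset ℕ, m (⋃ i ∈ s, f i) = ∑ i ∈ s, m (f i) := by
    intro f hf hd s
    induction s using Finset.induction_on with
    | empty => simpa using hempty
    | insert a s ha ih =>
      rw [Finset.set_biUnion_insert, Finset.sum_insert ha, hadd _ _ (hf a)
        (s.measurableSet_biUnion fun i _ => hf i), ih]
      rw [Set.disjoint_iUnion₂_right]
      intro i hi
      exact hd fun h => ha (h ▸ hi)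
  -- A vector measure must vanish on nonmeasurable sets, whereas `m` is unrestricted there.
  refine ⟨⟨fun A => if MeasurableSet A then m A else 0, by simp [hempty],
    fun A hA => by simp [hA], fun f hf hd => ?_⟩, ?_, fun A hA => ?_⟩
  · simp only [hf, MeasurableSet.iUnion hf, if_true]
    -- By finite additivity the error of a partial sum is `m (R s)`; `ν (R s)` tends to `0`, so
    -- `hcont` makes this error vanish.
    let R : Finset ℕ → Set Ω := fun s => ⋃ i : {i // i ∉ s}, f i
    have hR : ∀ s, MeasurableSet (R s) := fun s => MeasurableSet.iUnion fun i => hf i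
    have hsplit : ∀ s : Finset ℕ, ∑ i ∈ s, m (f i) = m (⋃ i, f i) - m (R s) := by
      intro s
      have h1 : (⋃ i, f i) = (⋃ i ∈ s, f i) ∪ R s := by
        ext x
        simp only [R, Set.mem_iUnion, Set.mem_union, Subtype.exists, exists_prop]
        constructor
        · rintro ⟨i, hi⟩
          by_cases h : i ∈ s
          · exact Or.inl ⟨i, h, hi⟩
          · exact Or.inr ⟨i, h, hi⟩
        · rintro (⟨i, _, hi⟩ | ⟨i, _, hi⟩) <;> exact ⟨i, hi⟩
      have h2 : Disjoint (⋃ i ∈ s, f i) (R s) := by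
        rw [Set.disjoint_iUnion₂_left]
        intro i hi
        rw [Set.disjoint_iUnion_right]
        rintro ⟨j, hj⟩
        exact hd fun h : i = j => hj (h ▸ hi)
      rw [h1, hadd _ _ (s.measurableSet_biUnion fun i _ => hf i) (hR s) h2, hfin f hf hd]
      ring
    have hRν : Tendsto (fun s => ν.real (R s)) atTop (𝓝 0) := by
      have h1 : ∑' i, ν (f i) ≠ ⊤ := by
        rw [← measure_iUnion hd hf]
        exact measure_ne_top _ _
      have h2 : Tendsto (fun s => ν (R s)) atTop (𝓝 0) :=
        tendsto_of_tendsto_of_tendsto_of_le_of_le tendsto_const_nhds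
          (ENNReal.tendsto_tsum_compl_atTop_zero h1) (fun _ => bot_le)
          fun s => measure_iUnion_le _
      exact (ENNReal.tendsto_toReal ENNReal.zero_ne_top).comp h2
    have hRm : Tendsto (fun s => m (R s)) atTop (𝓝 0) := by
      rw [Metric.tendsto_nhds]
      intro e he
      obtain ⟨d, hd0, hd⟩ := hcont e he
      filter_upwards [hRν.eventually (gt_mem_nhds hd0)] with s hs
      rw [Real.dist_eq, sub_zero]
      exact hd _ (hR s) hs
    have : Tendsto (fun s => m (⋃ i, f i) - m (R s)) atTop (𝓝 (m (⋃ i, f i) - 0)) :=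
      tendsto_const_nhds.sub hRm
    rw [sub_zero] at this
    change Tendsto (fun s : Finset ℕ => ∑ i ∈ s, m (f i)) atTop (𝓝 (m (⋃ i, f i)))
    simpa only [hsplit] using this
  · refine VectorMeasure.AbsolutelyContinuous.mk fun A hA h => ?_
    rw [Measure.toENNRealVectorMeasure_apply_measurable hA] at h
    change (if MeasurableSet A then m A else 0) = 0
    rw [if_pos hA]
    by_contra hne
    obtain ⟨d, hd0, hd⟩ := hcont |m A| (abs_pos.2 hne)
    exact lt_irrefl _ (hd A hA (by simpa [Measure.real, h] using hd0))
  · change (if MeasurableSet A then m A else 0) = m A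
    rw [if_pos hA]

variable {φ : ℝ → EReal} (hφ : IsGenerator φ)
  (hφ' : Tendsto (fun x : ℝ => φ x / (x : EReal)) atTop (𝓝 ⊤))
include hφ hφ'

omit [IsFiniteMeasure ν] in
-- Approximants based at `0` stay within `|h|` of `h`, so `θ(k h)` dominates `θ(k (h - s))`. Its
-- integrability for arbitrarily large `k` is what membership in the heart provides.
theorem HeartFun.exists_simpleFunc_integral_young_le {h : Ω → ℝ} (hh : HeartFun φ ν h) (k : ℝ) :
    ∃ s : SimpleFunc Ω ℝ, ∫ ω, young φ (k * (h ω - s ω)) ∂ν ≤ 1 := by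
  set g := hh.1.aemeasurable.mk h with hg
  have hgm : Measurable g := hh.1.aemeasurable.measurable_mk
  have hgh : h =ᵐ[ν] g := hh.1.aemeasurable.ae_eq_mk
  let s : ℕ → SimpleFunc Ω ℝ := fun n => SimpleFunc.approxOn g hgm Set.univ 0 (Set.mem_univ 0) n
  have hcy := continuous_young hφ hφ'
  have hlim : Tendsto (fun n => ∫ ω, young φ (k * (g ω - s n ω)) ∂ν) atTop
      (𝓝 (∫ _, (0 : ℝ) ∂ν)) := by
    refine tendsto_integral_of_dominated_convergence (fun ω => young φ (k * h ω))
      (fun n => (hcy.measurable.comp ((hgm.sub (s n).measurable).const_mul k)).aestronglyMeasurable)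
      (hh.2 k) (fun n => ?_) (ae_of_all _ fun ω => ?_)
    · filter_upwards [hgh] with ω hω
      rw [Real.norm_eq_abs, abs_of_nonneg (young_nonneg hφ _)]
      refine young_le_of_abs_le hφ hφ' ?_
      rw [abs_mul, abs_mul, hω]
      refine mul_le_mul_of_nonneg_left ?_ (abs_nonneg k)
      have h1 := SimpleFunc.edist_approxOn_le hgm (Set.mem_univ (0 : ℝ)) ω n
      rw [edist_dist, edist_dist, ENNReal.ofReal_le_ofReal_iff dist_nonneg, Real.dist_eq,
        Real.dist_eq, zero_sub, abs_neg, abs_sub_comm] at h1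
      exact h1
    · have h1 : Tendsto (fun n => s n ω) atTop (𝓝 (g ω)) :=
        SimpleFunc.tendsto_approxOn hgm (Set.mem_univ 0) (by simp)
      have h2 : Tendsto (fun n => k * (g ω - s n ω)) atTop (𝓝 (k * (g ω - g ω))) :=
        (tendsto_const_nhds.sub h1).const_mul k
      rw [sub_self, mul_zero] at h2
      have h3 := (hcy.tendsto 0).comp h2
      rwa [young_zero hφ hφ'] at h3
  rw [integral_zero] at hlim
  obtain ⟨n, hn⟩ := (hlim.eventually (gt_mem_nhds one_pos)).exists
  refine ⟨s n, ?_⟩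
  have : ∫ ω, young φ (k * (h ω - s n ω)) ∂ν = ∫ ω, young φ (k * (g ω - s n ω)) ∂ν := by
    refine integral_congr_ae ?_
    filter_upwards [hgh] with ω hω
    rw [hω]
  rw [this]
  exact hn.le

omit [IsFiniteMeasure ν] in
-- Young's inequality for `k * h`, divided by `k`: a large `k` suppresses the contribution `T` of
-- the divergence.
theorem abs_integral_mul_le {u h : Ω → ℝ} (hu : AEStronglyMeasurable u ν) {T : ℝ} (hT : 0 ≤ T)
    (huT : ∫⁻ ω, (psi φ (u ω)).toENNReal ∂ν ≤ ENNReal.ofReal T) (hh : HeartFun φ ν h)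
    {k : ℝ} (hk : 0 < k) :
    |∫ ω, u ω * h ω ∂ν| ≤ (T + ∫ ω, young φ (k * h ω) ∂ν) / k := by
  rw [le_div_iff₀ hk]
  have := (integral_mul_le hφ hφ' hu hT huT (hh.const_mul k)).2.1
  have h2 : ∫ ω, u ω * (k * h ω) ∂ν = k * ∫ ω, u ω * h ω ∂ν := by
    rw [← integral_const_mul]
    congr 1 with ω
    ring
  rwa [h2, abs_mul, abs_of_pos hk, mul_comm] at this

theorem tendsto_integral_mul_of_simpleFunc {ι : Type*} {l : Filter ι} {u : ι → Ω → ℝ}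
    (hu : ∀ i, AEStronglyMeasurable (u i) ν) {B : ℝ} (hB : 0 ≤ B)
    (huB : ∀ᶠ i in l, ∫⁻ ω, (psi φ (u i ω)).toENNReal ∂ν ≤ ENNReal.ofReal B)
    {v : Ω → ℝ} (hv : AEStronglyMeasurable v ν)
    (hvB : ∫⁻ ω, (psi φ (v ω)).toENNReal ∂ν ≤ ENNReal.ofReal B)
    (hs : ∀ s : SimpleFunc Ω ℝ,
      Tendsto (fun i => ∫ ω, u i ω * s ω ∂ν) l (𝓝 (∫ ω, v ω * s ω ∂ν)))
    {h : Ω → ℝ} (hh : HeartFun φ ν h) :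
    Tendsto (fun i => ∫ ω, u i ω * h ω ∂ν) l (𝓝 (∫ ω, v ω * h ω ∂ν)) := by
  rw [Metric.tendsto_nhds]
  intro e he
  -- Chosen so that `(B + 1) / k = e / 4`, the `1` coming from the modular of `k * (h - s)`.
  set k := 4 * (B + 1) / e with hk
  have hk0 : 0 < k := by positivity
  obtain ⟨s, hsk⟩ := hh.exists_simpleFunc_integral_young_le hφ hφ' k
  have hsh := heartFun_simpleFunc (ν := ν) hφ hφ' s
  have hd : HeartFun φ ν fun ω => h ω - s ω := by
    have := hh.add hφ hφ' (hsh.const_mul (-1))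
    simpa [sub_eq_add_neg] using this
  have key : ∀ w : Ω → ℝ, AEStronglyMeasurable w ν →
      ∫⁻ ω, (psi φ (w ω)).toENNReal ∂ν ≤ ENNReal.ofReal B →
      |∫ ω, w ω * h ω ∂ν - ∫ ω, w ω * s ω ∂ν| ≤ e / 4 := by
    intro w hw hwB
    rw [← integral_sub (integral_mul_le hφ hφ' hw hB hwB hh).1
      (integral_mul_le hφ hφ' hw hB hwB hsh).1]
    simp only [← mul_sub]
    refine (abs_integral_mul_le hφ hφ' hw hB hwB hd hk0).trans ?_
    rw [div_le_iff₀ hk0]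
    have : e / 4 * k = B + 1 := by rw [hk]; field_simp
    linarith
  filter_upwards [huB, (Metric.tendsto_nhds.1 (hs s)) (e / 4) (by positivity)] with i hi hi2
  have h1 := abs_le.1 (key (u i) (hu i) hi)
  have h2 := abs_le.1 (key v hv hvB)
  rw [Real.dist_eq] at hi2 ⊢
  have h3 := abs_lt.1 hi2
  rw [abs_lt]
  constructor <;> linarith [h1.1, h1.2, h2.1, h2.2, h3.1, h3.2]

/-- Limits along ultrafilters of densities with bounded divergence. -/
theorem exists_tendsto_integral_mul {ι : Type*} (U : Ultrafilter ι) {u : ι → Ω → ℝ}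
    (hu : ∀ i, AEStronglyMeasurable (u i) ν) {T : ι → ℝ} {t : ℝ} (hT : Tendsto T U (𝓝 t))
    (huT : ∀ᶠ i in (U : Filter ι), 0 ≤ T i ∧
      ∫⁻ ω, (psi φ (u i ω)).toENNReal ∂ν ≤ ENNReal.ofReal (T i)) :
    ∃ v : Ω → ℝ, Measurable v ∧ Integrable v ν ∧
      ∫⁻ ω, (psi φ (v ω)).toENNReal ∂ν ≤ ENNReal.ofReal t ∧
      ∀ h : Ω → ℝ, HeartFun φ ν h →
        Tendsto (fun i => ∫ ω, u i ω * h ω ∂ν) U (𝓝 (∫ ω, v ω * h ω ∂ν)) := by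
  have ht0 : 0 ≤ t := ge_of_tendsto hT (huT.mono fun i hi => hi.1)
  -- A fixed bound, eventually above every `T i`; the sharp bound `t` is recovered only at the end.
  set B := t + 1 with hB
  have hB0 : 0 ≤ B := by linarith
  have huB : ∀ᶠ i in (U : Filter ι),
      ∫⁻ ω, (psi φ (u i ω)).toENNReal ∂ν ≤ ENNReal.ofReal B := by
    filter_upwards [huT, hT.eventually (gt_mem_nhds (show t < B by linarith))] with i h1 h2
    exact h1.2.trans (ENNReal.ofReal_le_ofReal h2.le)
  have hlim : ∀ h : Ω → ℝ, HeartFun φ ν h →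
      ∃ c, Tendsto (fun i => ∫ ω, u i ω * h ω ∂ν) U (𝓝 c) := by
    intro h hh
    set b := B + ∫ ω, young φ (h ω) ∂ν
    obtain ⟨c, _, hc⟩ := (isCompact_Icc (a := -b) (b := b)).ultrafilter_le_nhds
      (U.map fun i => ∫ ω, u i ω * h ω ∂ν) (by
        rw [le_principal_iff]
        change ∀ᶠ i in (U : Filter ι), _
        filter_upwards [huB] with i hi
        exact abs_le.1 (integral_mul_le hφ hφ' (hu i) hB0 hi hh).2.1)
    exact ⟨c, hc⟩
  have hind : ∀ A, MeasurableSet A → HeartFun φ ν (A.indicator 1) := fun A hA =>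
    heartFun_of_bounded hφ hφ' (c := 1) (measurable_one.indicator hA).aestronglyMeasurable
      fun ω => by by_cases h : ω ∈ A <;> simp [h]
  set m : Set Ω → ℝ := fun A => limUnder U fun i => ∫ ω, u i ω * A.indicator 1 ω ∂ν with hm
  have hmlim : ∀ A, MeasurableSet A →
      Tendsto (fun i => ∫ ω, u i ω * A.indicator 1 ω ∂ν) U (𝓝 (m A)) := fun A hA =>
    tendsto_nhds_limUnder (hlim _ (hind A hA))
  obtain ⟨μ, hμν, hμ⟩ := exists_signedMeasure (ν := ν) (m := m)
    (fun A C hA hC hAC => by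
      refine tendsto_nhds_unique (hmlim _ (hA.union hC)) ?_
      refine ((hmlim A hA).add (hmlim C hC)).congr' ?_
      filter_upwards [huB] with i hi
      rw [← integral_add (integral_mul_le hφ hφ' (hu i) hB0 hi (hind A hA)).1
        (integral_mul_le hφ hφ' (hu i) hB0 hi (hind C hC)).1]
      congr 1 with ω
      rw [Set.indicator_union_of_disjoint hAC]
      ring)
    (fun e he => by
      -- This makes `B / k` less than `e / 2`; the threshold on `ν.real A` below keeps `young φ k *
      -- ν.real A / k` at most `e / 2`.
      set k := 2 * (B + 1) / e with hk
      have hk0 : 0 < k := by positivity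
      have hy0 := young_nonneg hφ k
      refine ⟨k * e / (2 * (young φ k + 1)), by positivity, fun A hA hνA => ?_⟩
      have h1 : ∫ ω, young φ (k * A.indicator 1 ω) ∂ν = young φ k * ν.real A := by
        have : (fun ω => young φ (k * A.indicator 1 ω)) = A.indicator fun _ => young φ k := by
          ext ω
          by_cases h : ω ∈ A <;> simp [h, young_zero hφ hφ']
        rw [this, integral_indicator_const _ hA, smul_eq_mul, mul_comm]
      have h2 : |m A| ≤ (B + young φ k * ν.real A) / k := by
        refine le_of_tendsto (hmlim A hA).abs ?_
        filter_upwards [huB] with i hi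
        rw [← h1]
        exact abs_integral_mul_le hφ hφ' (hu i) hB0 hi (hind A hA) hk0
      refine h2.trans_lt ?_
      rw [div_lt_iff₀ hk0]
      rw [lt_div_iff₀ (by positivity)] at hνA
      have h3 : e * k = 2 * (B + 1) := by rw [hk]; field_simp
      have h4 : 0 ≤ ν.real A := measureReal_nonneg
      nlinarith)
  set v := μ.rnDeriv ν with hv
  have hvm : Measurable v := SignedMeasure.measurable_rnDeriv μ ν
  have hvi : Integrable v ν := SignedMeasure.integrable_rnDeriv μ ν
  have hvA : ∀ A, MeasurableSet A → m A = ∫ ω, v ω * A.indicator 1 ω ∂ν := by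
    intro A hA
    rw [← hμ A hA, ← SignedMeasure.withDensityᵥ_rnDeriv_eq μ ν hμν, withDensityᵥ_apply hvi hA,
      ← integral_indicator hA]
    congr 1 with ω
    by_cases h : ω ∈ A <;> simp [h, hv]
  have hs : ∀ s : SimpleFunc Ω ℝ,
      Tendsto (fun i => ∫ ω, u i ω * s ω ∂ν) U (𝓝 (∫ ω, v ω * s ω ∂ν)) := by
    intro s
    induction s using SimpleFunc.induction with
    | @const c A hA =>
      have h1 : ∀ w : Ω → ℝ, ∫ ω, w ω * (SimpleFunc.piecewise A hA (SimpleFunc.const Ω c)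
          (SimpleFunc.const Ω 0)) ω ∂ν = c * ∫ ω, w ω * A.indicator 1 ω ∂ν := by
        intro w
        rw [← integral_const_mul]
        congr 1 with ω
        by_cases h : ω ∈ A <;> simp [h, mul_comm]
      simp only [h1]
      rw [← hvA A hA]
      exact (hmlim A hA).const_mul c
    | @add f g _ hf hg =>
      have h1 : ∫ ω, v ω * (f + g) ω ∂ν = ∫ ω, v ω * f ω ∂ν + ∫ ω, v ω * g ω ∂ν := by
        rw [← integral_add]
        · simp [mul_add]
        · simpa only [mul_comm] using integrable_simpleFunc_mul hvi f
        · simpa only [mul_comm] using integrable_simpleFunc_mul hvi g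
      rw [h1]
      refine (hf.add hg).congr' ?_
      filter_upwards [huB] with i hi
      rw [← integral_add
        (integral_mul_le hφ hφ' (hu i) hB0 hi (heartFun_simpleFunc hφ hφ' f)).1
        (integral_mul_le hφ hφ' (hu i) hB0 hi (heartFun_simpleFunc hφ hφ' g)).1]
      simp [mul_add]
  -- The one-sided Young inequality, with `ψ*` rather than `θ`, passes to the limit for each simple
  -- `h` and keeps the exact constant `t`.
  have hvt : ∫⁻ ω, (psi φ (v ω)).toENNReal ∂ν ≤ ENNReal.ofReal t := by
    refine lintegral_psi_le hφ hφ' hvm hvi fun h s hsh => ?_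
    have hhh := heartFun_simpleFunc (ν := ν) hφ hφ' h
    have h1 : ∫ ω, v ω * h ω ∂ν ≤ t + ∫ ω, legendre φ (h ω) ∂ν := by
      refine le_of_tendsto_of_tendsto (hs h) (hT.add_const _) ?_
      filter_upwards [huT] with i hi
      exact (integral_mul_le hφ hφ' (hu i) hi.1 hi.2 hhh).2.2
    have h2 : ∫ ω, legendre φ (h ω) ∂ν ≤ ∫ ω, s ω ∂ν :=
      integral_mono (hhh.integrable_legendre hφ hφ') s.integrable_of_isFiniteMeasure hsh
    rw [integral_sub (integrable_simpleFunc_mul hvi h) s.integrable_of_isFiniteMeasure]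
    simp only [mul_comm (h _)]
    linarith
  refine ⟨v, hvm, hvi, hvt, fun h hh => ?_⟩
  exact tendsto_integral_mul_of_simpleFunc hφ hφ' hu hB0 huB hvm.aestronglyMeasurable
    (hvt.trans (ENNReal.ofReal_le_ofReal (by linarith))) hs hh

end Compactness

section Divergence

/-! ### Divergences and densities -/

theorem coe_ennreal_le_coe_iff {x : ℝ≥0∞} {t : ℝ} :
    (x : EReal) ≤ (t : EReal) ↔ 0 ≤ t ∧ x ≤ ENNReal.ofReal t := by
  constructor
  · intro h
    have h0 : 0 ≤ t := by exact_mod_cast (EReal.coe_ennreal_nonneg x).trans h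
    refine ⟨h0, EReal.coe_ennreal_le_coe_ennreal_iff.1 ?_⟩
    rwa [EReal.coe_ennreal_ofReal, max_eq_left h0]
  · rintro ⟨h0, h⟩
    have := EReal.coe_ennreal_le_coe_ennreal_iff.2 h
    rwa [EReal.coe_ennreal_ofReal, max_eq_left h0] at this

variable {Ω : Type*} [MeasurableSpace Ω] {ν : Measure Ω} [IsFiniteMeasure ν] {φ : ℝ → EReal}

theorem IsGenerator.slopeAt_atBot (hφ : IsGenerator φ) : slopeAt φ atBot = ⊥ := by
  refine Tendsto.limUnder_eq (tendsto_const_nhds.congr' ?_)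
  filter_upwards [eventually_lt_atBot (0 : ℝ)] with x hx
  rw [hφ.eq_top_of_neg x hx, EReal.top_div_of_neg_ne_bot (by exact_mod_cast hx)
    (EReal.coe_ne_bot x)]

omit [IsFiniteMeasure ν] in
theorem div_withDensityᵥ {f : Ω → ℝ} (hf : Integrable f ν) :
    div φ (ν.withDensityᵥ f) ν = (intFun φ ν f : EReal) := by
  have h0 : (0 : SignedMeasure Ω).MutuallySingular ν.toENNRealVectorMeasure :=
    VectorMeasure.MutuallySingular.zero_left
  have hs : SignedMeasure.singularPart (ν.withDensityᵥ f) ν = 0 :=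
    (SignedMeasure.eq_singularPart 0 f h0 (by rw [zero_add])).symm
  have hr : f =ᵐ[ν] SignedMeasure.rnDeriv (ν.withDensityᵥ f) ν :=
    SignedMeasure.eq_rnDeriv 0 f hf h0 (by rw [zero_add])
  have hi : intFun φ ν (SignedMeasure.rnDeriv (ν.withDensityᵥ f) ν) = intFun φ ν f := by
    refine lintegral_congr_ae ?_
    filter_upwards [hr] with ω hω
    rw [hω]
  simp [div, hs, hi, SignedMeasure.toJordanDecomposition_zero]

omit [IsFiniteMeasure ν] in
theorem totalVariation_withDensityᵥ {f : Ω → ℝ} (hf : Integrable f ν) (h0 : 0 ≤ᵐ[ν] f) :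
    (SignedMeasure.toJordanDecomposition (ν.withDensityᵥ f)).posPart =
        ν.withDensity (fun ω => ENNReal.ofReal (f ω)) ∧
      (SignedMeasure.toJordanDecomposition (ν.withDensityᵥ f)).negPart = 0 ∧
      SignedMeasure.totalVariation (ν.withDensityᵥ f) =
        ν.withDensity (fun ω => ENNReal.ofReal (f ω)) := by
  have hfin := isFiniteMeasure_withDensity_ofReal hf.2
  have hj : SignedMeasure.toJordanDecomposition (ν.withDensityᵥ f) =
      ⟨ν.withDensity fun ω => ENNReal.ofReal (f ω), 0, Measure.MutuallySingular.zero_right⟩ := by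
    refine SignedMeasure.toJordanDecomposition_eq ?_
    rw [JordanDecomposition.toSignedMeasure]
    simp only [Measure.toSignedMeasure_zero, sub_zero]
    have hne : ∫⁻ ω, ENNReal.ofReal (f ω) ∂ν ≠ ⊤ := by
      rw [← setLIntegral_univ, ← withDensity_apply _ MeasurableSet.univ]
      exact measure_ne_top _ _
    rw [← withDensityᵥ_toReal hf.1.aemeasurable.ennreal_ofReal hne]
    refine WithDensityᵥEq.congr_ae ?_
    filter_upwards [h0] with ω hω
    exact (ENNReal.toReal_ofReal hω).symm
  refine ⟨by rw [hj], by rw [hj], by rw [SignedMeasure.totalVariation, hj]; simp⟩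

omit [IsFiniteMeasure ν] in
theorem sint_withDensityᵥ {f : Ω → ℝ} (hf : Integrable f ν) (h0 : 0 ≤ᵐ[ν] f) (g : Ω → ℝ) :
    sint (ν.withDensityᵥ f) g = ∫ ω, f ω * g ω ∂ν := by
  obtain ⟨h1, h2, -⟩ := totalVariation_withDensityᵥ hf h0
  rw [sint, h1, h2, integral_zero_measure, sub_zero,
    integral_withDensity_eq_integral_toReal_smul₀ hf.1.aemeasurable.ennreal_ofReal
      (ae_of_all _ fun _ => ENNReal.ofReal_lt_top)]
  refine integral_congr_ae ?_
  filter_upwards [h0] with ω hω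
  rw [ENNReal.toReal_ofReal hω, smul_eq_mul]

omit [IsFiniteMeasure ν] in
theorem integrable_totalVariation_withDensityᵥ {f : Ω → ℝ} (hf : Integrable f ν)
    (h0 : 0 ≤ᵐ[ν] f) {g : Ω → ℝ} (hg : Integrable (fun ω => f ω * g ω) ν) :
    Integrable g (SignedMeasure.totalVariation (ν.withDensityᵥ f)) := by
  rw [(totalVariation_withDensityᵥ hf h0).2.2,
    integrable_withDensity_iff_integrable_smul₀' hf.1.aemeasurable.ennreal_ofReal
      (ae_of_all _ fun _ => ENNReal.ofReal_lt_top)]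
  refine hg.congr ?_
  filter_upwards [h0] with ω hω
  rw [ENNReal.toReal_ofReal hω, smul_eq_mul]

omit [IsFiniteMeasure ν] in
theorem withDensityᵥ_mem_probs {f : Ω → ℝ} (hf : Integrable f ν) (h0 : 0 ≤ᵐ[ν] f)
    (h1 : ∫ ω, f ω ∂ν = 1) : ν.withDensityᵥ f ∈ probs Ω := by
  refine ⟨?_, ?_⟩
  · rw [VectorMeasure.le_iff]
    intro A hA
    rw [withDensityᵥ_apply hf hA]
    exact setIntegral_nonneg_of_ae h0
  · rw [withDensityᵥ_apply hf MeasurableSet.univ, setIntegral_univ, h1]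

variable (hφ : IsGenerator φ) (hφ' : Tendsto (fun x : ℝ => φ x / (x : EReal)) atTop (𝓝 ⊤))
include hφ

omit [IsFiniteMeasure ν] in
theorem ae_nonneg_of_intFun_ne_top {f : Ω → ℝ} (hf : AEStronglyMeasurable f ν)
    (h : intFun φ ν f ≠ ⊤) : 0 ≤ᵐ[ν] f := by
  have hm : AEMeasurable (fun ω => (φ (f ω)).toENNReal) ν :=
    (hφ.lsc.measurable.comp_aemeasurable hf.aemeasurable).ereal_toENNReal
  filter_upwards [ae_lt_top' hm h] with ω hω
  by_contra hneg
  rw [hφ.eq_top_of_neg _ (not_le.1 hneg)] at hω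
  simp at hω

include hφ'

/-- A signed measure with finite divergence has a nonnegative density. -/
theorem eq_withDensityᵥ_of_div_ne_top {μ : SignedMeasure Ω} (hμ : div φ μ ν ≠ ⊤) :
    μ = ν.withDensityᵥ (μ.rnDeriv ν) ∧ div φ μ ν = (intFun φ ν (μ.rnDeriv ν) : EReal) ∧
      0 ≤ᵐ[ν] μ.rnDeriv ν := by
  set p := (μ.singularPart ν).toJordanDecomposition.posPart with hp
  set n := (μ.singularPart ν).toJordanDecomposition.negPart with hn
  have hdiv : div φ μ ν = (intFun φ ν (μ.rnDeriv ν) : EReal) + (p Set.univ : EReal) * ⊤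
      - (n Set.univ : EReal) * ⊥ := by
    rw [div, slopeAt_atTop hφ', hφ.slopeAt_atBot]
  -- The slopes are `⊤` and `⊥`, so singular mass of either sign drives the divergence to `⊤`.
  have hp0 : p Set.univ = 0 := by
    by_contra h
    have h1 : (p Set.univ : EReal) * ⊤ = ⊤ :=
      EReal.mul_top_of_pos (by rw [EReal.coe_ennreal_pos]; exact pos_iff_ne_zero.2 h)
    rw [h1, EReal.add_top_of_ne_bot (EReal.coe_ennreal_ne_bot _)] at hdiv
    refine hμ (hdiv.trans ?_)
    by_cases h2 : n Set.univ = 0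
    · simp [h2]
    · rw [EReal.mul_bot_of_pos (by rw [EReal.coe_ennreal_pos]; exact pos_iff_ne_zero.2 h2)]
      rfl
  have hn0 : n Set.univ = 0 := by
    by_contra h
    rw [EReal.mul_bot_of_pos (by rw [EReal.coe_ennreal_pos]; exact pos_iff_ne_zero.2 h), hp0,
      EReal.coe_ennreal_zero, zero_mul, add_zero, EReal.sub_bot (EReal.coe_ennreal_ne_bot _)]
      at hdiv
    exact hμ hdiv
  have hs : μ.singularPart ν = 0 := by
    rw [← SignedMeasure.toSignedMeasure_toJordanDecomposition (μ.singularPart ν),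
      JordanDecomposition.toSignedMeasure]
    ext A hA
    rw [Measure.toSignedMeasure_sub_apply hA, ← hp, ← hn]
    simp [Measure.real, measure_mono_null (Set.subset_univ A) hp0,
      measure_mono_null (Set.subset_univ A) hn0]
  have hdens : μ = ν.withDensityᵥ (μ.rnDeriv ν) := by
    conv_lhs => rw [← SignedMeasure.singularPart_add_withDensity_rnDeriv_eq ν μ, hs, zero_add]
  have hd : div φ μ ν = (intFun φ ν (μ.rnDeriv ν) : EReal) := by
    rw [hdiv, hp0, hn0]
    simp
  refine ⟨hdens, hd, ae_nonneg_of_intFun_ne_top hφ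
    (SignedMeasure.measurable_rnDeriv μ ν).aestronglyMeasurable ?_⟩
  rw [hd] at hμ
  simpa using hμ

omit hφ' in
/-- The measure with density `1 + v`. -/
theorem div_withDensityᵥ_one_add_le {v : Ω → ℝ} (hv : Integrable v ν) {t : ℝ} (ht : 0 ≤ t)
    (hvt : ∫⁻ ω, (psi φ (v ω)).toENNReal ∂ν ≤ ENNReal.ofReal t) :
    Integrable (fun ω => v ω + 1) ν ∧ (0 ≤ᵐ[ν] fun ω => v ω + 1) ∧
      div φ (ν.withDensityᵥ fun ω => v ω + 1) ν ≤ (t : EReal) := by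
  have hi : Integrable (fun ω => v ω + 1) ν := hv.add (integrable_const 1)
  have hI : intFun φ ν (fun ω => v ω + 1) ≤ ENNReal.ofReal t := by
    rw [intFun_eq_lintegral_psi]
    simpa using hvt
  refine ⟨hi, ae_nonneg_of_intFun_ne_top hφ hi.1
    (ne_top_of_le_ne_top ENNReal.ofReal_ne_top hI), ?_⟩
  rw [div_withDensityᵥ hi]
  exact coe_ennreal_le_coe_iff.2 ⟨ht, hI⟩

theorem mem_ball {τ : ℝ} {μ : SignedMeasure Ω} (hμ : μ ∈ ball φ ν τ) :
    μ = ν.withDensityᵥ (μ.rnDeriv ν) ∧ (0 ≤ᵐ[ν] μ.rnDeriv ν) ∧ 0 ≤ τ ∧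
      ∫⁻ ω, (psi φ (μ.rnDeriv ν ω - 1)).toENNReal ∂ν ≤ ENNReal.ofReal τ := by
  obtain ⟨h1, h2, h3⟩ := eq_withDensityᵥ_of_div_ne_top hφ hφ'
    (ne_top_of_le_ne_top (EReal.coe_ne_top τ) hμ)
  have h4 : div φ μ ν ≤ (τ : EReal) := hμ
  rw [h2, intFun_eq_lintegral_psi] at h4
  obtain ⟨h5, h6⟩ := coe_ennreal_le_coe_iff.1 h4
  exact ⟨h1, h3, h5, h6⟩

omit hφ hφ' [IsFiniteMeasure ν] in
theorem measurable_rnDeriv_sub_one (μ : SignedMeasure Ω) :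
    Measurable fun ω => μ.rnDeriv ν ω - 1 :=
  (SignedMeasure.measurable_rnDeriv μ ν).sub_const 1

theorem integrable_rnDeriv_mul {τ : ℝ} {μ : SignedMeasure Ω} (hμ : μ ∈ ball φ ν τ) {g : Ω → ℝ}
    (hg : HeartFun φ ν g) : Integrable (fun ω => μ.rnDeriv ν ω * g ω) ν := by
  obtain ⟨_, _, h5, h6⟩ := mem_ball hφ hφ' hμ
  have := (integral_mul_le hφ hφ' (measurable_rnDeriv_sub_one μ).aestronglyMeasurable h5 h6 hg).1
  refine (this.add (hg.integrable hφ hφ')).congr (ae_of_all _ fun ω => ?_)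
  simp only [Pi.add_apply]
  ring

theorem ball_absolutelyContinuous {τ : ℝ} {μ : SignedMeasure Ω} (hμ : μ ∈ ball φ ν τ) :
    μ.totalVariation ≪ ν := by
  obtain ⟨h1, h3, _, _⟩ := mem_ball hφ hφ' hμ
  rw [h1, (totalVariation_withDensityᵥ (SignedMeasure.integrable_rnDeriv μ ν) h3).2.2]
  exact withDensity_absolutelyContinuous _ _

theorem ball_integrable {τ : ℝ} {μ : SignedMeasure Ω} (hμ : μ ∈ ball φ ν τ) {g : Ω → ℝ}
    (hg : HeartFun φ ν g) : Integrable g μ.totalVariation := by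
  obtain ⟨h1, h3, _, _⟩ := mem_ball hφ hφ' hμ
  rw [h1]
  exact integrable_totalVariation_withDensityᵥ (SignedMeasure.integrable_rnDeriv μ ν) h3
    (integrable_rnDeriv_mul hφ hφ' hμ hg)

theorem sint_eq_of_mem_ball {τ : ℝ} {μ : SignedMeasure Ω} (hμ : μ ∈ ball φ ν τ) {g : Ω → ℝ}
    (hg : HeartFun φ ν g) :
    sint μ g = ∫ ω, (μ.rnDeriv ν ω - 1) * g ω ∂ν + ∫ ω, g ω ∂ν := by
  obtain ⟨h1, h3, h5, h6⟩ := mem_ball hφ hφ' hμ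
  conv_lhs => rw [h1]
  rw [sint_withDensityᵥ (SignedMeasure.integrable_rnDeriv μ ν) h3, ← integral_add
    (integral_mul_le hφ hφ' (measurable_rnDeriv_sub_one μ).aestronglyMeasurable h5 h6 hg).1
    (hg.integrable hφ hφ')]
  congr 1 with ω
  ring

theorem univ_eq_of_mem_ball {τ : ℝ} {μ : SignedMeasure Ω} (hμ : μ ∈ ball φ ν τ) :
    μ Set.univ = ∫ ω, (μ.rnDeriv ν ω - 1) ∂ν + ν.real Set.univ := by
  obtain ⟨h1, -⟩ := mem_ball hφ hφ' hμ
  have hi := SignedMeasure.integrable_rnDeriv μ ν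
  conv_lhs => rw [h1]
  rw [withDensityᵥ_apply hi MeasurableSet.univ, setIntegral_univ,
    integral_sub hi (integrable_const 1)]
  simp

/-! ### Compactness in the initial topologies. -/

omit hφ hφ' in
theorem le_nhds_iInf_induced {X I : Type*} {S : Set I} {F : I → X → ℝ} {l : Filter X} {x : X}
    (h : ∀ g ∈ S, Tendsto (F g) l (𝓝 (F g x))) :
    l ≤ @nhds X (⨅ g ∈ S, TopologicalSpace.induced (F g) inferInstance) x := by
  simp only [nhds_iInf, nhds_induced, le_iInf_iff, ← tendsto_iff_comap]
  exact h

theorem infCompact_intFun :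
    InfCompact (weakTopology ν (orliczSpace (conj (theta φ)) ν) (stronglySubexp φ ν))
      (fun f : orliczSpace (conj (theta φ)) ν => (intFun φ ν f.1 : EReal)) := by
  intro t
  let _ := weakTopology ν (orliczSpace (conj (theta φ)) ν) (stronglySubexp φ ν)
  rw [isCompact_iff_ultrafilter_le_nhds]
  intro U hU
  rw [le_principal_iff] at hU
  have hU' : ∀ᶠ f : orliczSpace (conj (theta φ)) ν in (U : Filter _),
      0 ≤ t ∧ ∫⁻ ω, (psi φ (f.1 ω - 1)).toENNReal ∂ν ≤ ENNReal.ofReal t := by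
    filter_upwards [hU] with f hf
    rw [← intFun_eq_lintegral_psi]
    exact coe_ennreal_le_coe_iff.1 hf
  obtain ⟨_, ht, _⟩ := hU'.exists
  have hum : ∀ f : orliczSpace (conj (theta φ)) ν,
      AEStronglyMeasurable (fun ω => f.1 ω - 1) ν := fun f =>
    f.1.aestronglyMeasurable.sub aestronglyMeasurable_const
  obtain ⟨v, hvm, hvi, hvt, hv⟩ := exists_tendsto_integral_mul hφ hφ' U
    (u := fun (f : orliczSpace (conj (theta φ)) ν) ω => f.1 ω - 1) (T := fun _ => t) hum
    tendsto_const_nhds hU'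
  -- The limit was taken for the centred densities `f - 1`; adding `1` back costs only the finite
  -- term `∫ g`.
  have hm : AEStronglyMeasurable (fun ω => v ω + 1) ν := (hvm.add_const 1).aestronglyMeasurable
  set f₀ : Ω →ₘ[ν] ℝ := AEEqFun.mk _ hm with hf₀
  have hf₀v : ∀ᵐ ω ∂ν, f₀ ω = v ω + 1 := AEEqFun.coeFn_mk _ _
  have hI : intFun φ ν f₀ ≤ ENNReal.ofReal t := by
    rw [intFun_eq_lintegral_psi]
    refine le_trans (lintegral_mono_ae ?_) hvt
    filter_upwards [hf₀v] with ω hω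
    rw [hω, add_sub_cancel_right]
  have hmem := mem_orliczSpace_of_intFun_ne_top hφ hφ'
    (ne_top_of_le_ne_top ENNReal.ofReal_ne_top hI)
  refine ⟨⟨f₀, hmem⟩, coe_ennreal_le_coe_iff.2 ⟨ht, hI⟩, ?_⟩
  refine le_nhds_iInf_induced
    (F := fun (g : Ω →ₘ[ν] ℝ) (f : orliczSpace (conj (theta φ)) ν) => ∫ ω, f.1 ω * g ω ∂ν)
    fun g hg => ?_
  rw [mem_stronglySubexp_iff hφ hφ'] at hg
  have h1 := (hv g hg).add_const (∫ ω, g ω ∂ν)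
  have h2 : ∫ ω, v ω * g ω ∂ν + ∫ ω, g ω ∂ν = ∫ ω, f₀ ω * g ω ∂ν := by
    rw [← integral_add (integral_mul_le hφ hφ' hvm.aestronglyMeasurable ht hvt hg).1
      (hg.integrable hφ hφ')]
    refine integral_congr_ae ?_
    filter_upwards [hf₀v] with ω hω
    rw [hω]
    ring
  rw [h2] at h1
  refine h1.congr' ?_
  filter_upwards [hU'] with f hf
  rw [← integral_add (integral_mul_le hφ hφ' (hum f) ht hf.2 hg).1 (hg.integrable hφ hφ')]
  congr 1 with ω
  ring

/-- One argument serves `Q = Set.univ` and `Q = probs Ω`. Limit densities are nonnegative because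
their divergence is finite, and total mass passes to the limit because constants lie in the heart.
-/
theorem compactSpace_ball_inter (τ : ℝ) (Q : Set (SignedMeasure Ω))
    (hQ : ∀ f : Ω → ℝ, Integrable f ν → 0 ≤ᵐ[ν] f →
      (∃ U : Ultrafilter ↥(Q ∩ ball φ ν τ),
        Tendsto (fun μ : ↥(Q ∩ ball φ ν τ) => μ.1 Set.univ) U (𝓝 (∫ ω, f ω ∂ν))) →
      ν.withDensityᵥ f ∈ Q) :
    @CompactSpace ↥(Q ∩ ball φ ν τ)
      (initialTopology (stronglySubexp φ ν) (Q ∩ ball φ ν τ)) := by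
  let _ := initialTopology (stronglySubexp φ ν) (Q ∩ ball φ ν τ)
  refine ⟨isCompact_iff_ultrafilter_le_nhds.2 fun U _ => ?_⟩
  have hball : ∀ μ : ↥(Q ∩ ball φ ν τ), μ.1 ∈ ball φ ν τ := fun μ => μ.2.2
  have hne : Nonempty ↥(Q ∩ ball φ ν τ) := U.neBot.nonempty
  have hτ : 0 ≤ τ := (mem_ball hφ hφ' (hball hne.some)).2.2.1
  obtain ⟨v, hvm, hvi, hvt, hv⟩ := exists_tendsto_integral_mul hφ hφ' U
    (u := fun (μ : ↥(Q ∩ ball φ ν τ)) ω => μ.1.rnDeriv ν ω - 1) (T := fun _ => τ)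
    (fun μ => (measurable_rnDeriv_sub_one μ.1).aestronglyMeasurable) tendsto_const_nhds
    (Eventually.of_forall fun μ =>
      ⟨hτ, (mem_ball hφ hφ' (hball μ)).2.2.2⟩)
  obtain ⟨hfi, hf0, hfd⟩ := div_withDensityᵥ_one_add_le hφ hvi hτ hvt
  have huniv : Tendsto (fun μ : ↥(Q ∩ ball φ ν τ) => μ.1 Set.univ) U
      (𝓝 (∫ ω, (v ω + 1) ∂ν)) := by
    have h1 := (hv (fun _ => 1) (heartFun_const 1)).add_const (ν.real Set.univ)
    simp only [mul_one] at h1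
    rw [integral_add hvi (integrable_const 1), integral_const, smul_eq_mul, mul_one]
    refine h1.congr fun μ => ?_
    rw [univ_eq_of_mem_ball hφ hφ' (hball μ)]
  refine ⟨⟨_, hQ _ hfi hf0 ⟨U, huniv⟩, hfd⟩, Set.mem_univ _, ?_⟩
  refine le_nhds_iInf_induced
    (F := fun (g : Ω →ₘ[ν] ℝ) (μ : ↥(Q ∩ ball φ ν τ)) => sint μ.1 g) fun g hg => ?_
  rw [mem_stronglySubexp_iff hφ hφ'] at hg
  have h1 := (hv g hg).add_const (∫ ω, g ω ∂ν)
  have h2 : ∫ ω, v ω * g ω ∂ν + ∫ ω, g ω ∂ν = sint (ν.withDensityᵥ fun ω => v ω + 1) g := by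
    rw [sint_withDensityᵥ hfi hf0, ← integral_add
      (integral_mul_le hφ hφ' hvm.aestronglyMeasurable hτ hvt hg).1 (hg.integrable hφ hφ')]
    congr 1 with ω
    ring
  rw [h2] at h1
  refine h1.congr fun μ => ?_
  rw [sint_eq_of_mem_ball hφ hφ' (hball μ) hg]

theorem compactSpace_ball (τ : ℝ) :
    @CompactSpace (ball φ ν τ) (initialTopology (stronglySubexp φ ν) (ball φ ν τ)) := by
  have := compactSpace_ball_inter (ν := ν) hφ hφ' τ Set.univ fun _ _ _ _ => Set.mem_univ _
  rwa [Set.univ_inter] at this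

theorem compactSpace_probs_inter_ball (τ : ℝ) :
    @CompactSpace ↥(probs Ω ∩ ball φ ν τ)
      (initialTopology (stronglySubexp φ ν) (probs Ω ∩ ball φ ν τ)) := by
  refine compactSpace_ball_inter hφ hφ' τ (probs Ω) fun f hf h0 ⟨U, hU⟩ => ?_
  refine withDensityᵥ_mem_probs hf h0 (tendsto_nhds_unique hU ?_)
  exact tendsto_const_nhds.congr fun μ => μ.2.1.2.symm

end Divergence

section Duality

/-! ### Strong duality -/

variable {Ω : Type*} [MeasurableSpace Ω] {ν : Measure Ω} {φ : ℝ → EReal}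

/-- The epigraph of the value function of the problem of minimizing `∫ ψ ∘ u dν` subject to
prescribed values of `∫ u g dν` and `∫ u dν`. -/
def valueEpi (φ : ℝ → EReal) (ν : Measure Ω) (g : Ω → ℝ) : Set ((ℝ × ℝ) × ℝ) :=
  {p | 0 ≤ p.2 ∧ ∃ u : Ω → ℝ, Measurable u ∧
    ∫⁻ ω, (psi φ (u ω)).toENNReal ∂ν ≤ ENNReal.ofReal p.2 ∧
    ∫ ω, u ω * g ω ∂ν = p.1.1 ∧ ∫ ω, u ω ∂ν = p.1.2}

variable (hφ : IsGenerator φ) (hφ' : Tendsto (fun x : ℝ => φ x / (x : EReal)) atTop (𝓝 ⊤))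
include hφ

theorem toENNReal_psi_add_le (x y : ℝ) {a b : ℝ} (ha : 0 < a) (hb : 0 < b) (hab : a + b = 1) :
    (psi φ (a * x + b * y)).toENNReal ≤
      ENNReal.ofReal a * (psi φ x).toENNReal + ENNReal.ofReal b * (psi φ y).toENNReal := by
  have ha' : ENNReal.ofReal a ≠ 0 := (ENNReal.ofReal_pos.2 ha).ne'
  have hb' : ENNReal.ofReal b ≠ 0 := (ENNReal.ofReal_pos.2 hb).ne'
  by_cases hx : psi φ x = ⊤
  · simp [hx, ENNReal.mul_top ha']
  by_cases hy : psi φ y = ⊤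
  · simp [hy, ENNReal.mul_top hb']
  have h1 : (x + 1, (psi φ x).toReal) ∈ {p : ℝ × ℝ | φ p.1 ≤ (p.2 : EReal)} :=
    EReal.le_coe_toReal hx
  have h2 : (y + 1, (psi φ y).toReal) ∈ {p : ℝ × ℝ | φ p.1 ≤ (p.2 : EReal)} :=
    EReal.le_coe_toReal hy
  have h3 : φ (a * (x + 1) + b * (y + 1)) ≤
      ((a * (psi φ x).toReal + b * (psi φ y).toReal : ℝ) : EReal) :=
    hφ.convex h1 h2 ha.le hb.le hab
  rw [show a * (x + 1) + b * (y + 1) = a * x + b * y + 1 by linear_combination hab] at h3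
  have hx0 := EReal.toReal_nonneg (hφ.coe_psi_nonneg x)
  have hy0 := EReal.toReal_nonneg (hφ.coe_psi_nonneg y)
  rw [EReal.toENNReal_of_ne_top hx, EReal.toENNReal_of_ne_top hy, ← ENNReal.ofReal_mul ha.le,
    ← ENNReal.ofReal_mul hb.le, ← ENNReal.ofReal_add (by positivity) (by positivity)]
  exact EReal.toENNReal_le_toENNReal h3

theorem zero_mem_valueEpi (g : Ω → ℝ) : (0, 0) ∈ valueEpi φ ν g :=
  ⟨le_rfl, 0, measurable_zero, by simp [hφ.psi_zero], by simp, by simp⟩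

variable [IsFiniteMeasure ν]
include hφ'

theorem convex_valueEpi {g : Ω → ℝ} (hg : HeartFun φ ν g) : Convex ℝ (valueEpi φ ν g) := by
  rw [convex_iff_forall_pos]
  rintro ⟨⟨x₁, y₁⟩, s₁⟩ ⟨hs₁, u₁, hm₁, hu₁, hx₁, hy₁⟩ ⟨⟨x₂, y₂⟩, s₂⟩ ⟨hs₂, u₂, hm₂, hu₂, hx₂, hy₂⟩
    a b ha hb hab
  simp only at hs₁ hs₂ hu₁ hu₂ hx₁ hx₂ hy₁ hy₂
  have hi : ∀ {u : Ω → ℝ} {s : ℝ} {h : Ω → ℝ}, HeartFun φ ν h → Measurable u → 0 ≤ s →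
      ∫⁻ ω, (psi φ (u ω)).toENNReal ∂ν ≤ ENNReal.ofReal s →
      Integrable (fun ω => u ω * h ω) ν := fun hh hm hs hu =>
    (integral_mul_le hφ hφ' hm.aestronglyMeasurable hs hu hh).1
  have key : ∀ h : Ω → ℝ, HeartFun φ ν h → ∫ ω, (a * u₁ ω + b * u₂ ω) * h ω ∂ν =
      a * ∫ ω, u₁ ω * h ω ∂ν + b * ∫ ω, u₂ ω * h ω ∂ν := by
    intro h hh
    rw [← integral_const_mul, ← integral_const_mul, ← integral_add
      ((hi hh hm₁ hs₁ hu₁).const_mul a) ((hi hh hm₂ hs₂ hu₂).const_mul b)]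
    congr 1 with ω
    ring
  have hpm : ∀ {u : Ω → ℝ}, Measurable u → Measurable fun ω => (psi φ (u ω)).toENNReal :=
    fun hu => (hφ.measurable_psi.comp hu).ereal_toENNReal
  refine ⟨by simp only [Prod.snd_add, Prod.smul_snd, smul_eq_mul]; positivity,
    fun ω => a * u₁ ω + b * u₂ ω, (hm₁.const_mul a).add (hm₂.const_mul b), ?_, ?_, ?_⟩
  · refine (lintegral_mono fun ω => toENNReal_psi_add_le hφ (u₁ ω) (u₂ ω) ha hb hab).trans ?_
    rw [lintegral_add_left ((hpm hm₁).const_mul _), lintegral_const_mul _ (hpm hm₁),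
      lintegral_const_mul _ (hpm hm₂)]
    simp only [Prod.snd_add, Prod.smul_snd, smul_eq_mul]
    rw [ENNReal.ofReal_add (by positivity) (by positivity), ENNReal.ofReal_mul ha.le,
      ENNReal.ofReal_mul hb.le]
    gcongr
  · rw [key g hg, hx₁, hx₂]
    simp
  · have := key (fun _ => 1) (heartFun_const 1)
    simp only [mul_one] at this
    rw [this, hy₁, hy₂]
    simp

/-- Witnesses along a convergent ultrafilter have a weak limit, which is a witness at the limit
point: `g` and `1` lie in the heart, so both constraints are continuous. Here the divergence bound
varies with the point. -/
theorem isClosed_valueEpi {g : Ω → ℝ} (hg : HeartFun φ ν g) : IsClosed (valueEpi φ ν g) := by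
  classical
  rw [isClosed_iff_ultrafilter]
  intro p U hU hmem
  let u : (ℝ × ℝ) × ℝ → Ω → ℝ := fun q =>
    if h : q ∈ valueEpi φ ν g then h.2.choose else 0
  have hu : ∀ q, (h : q ∈ valueEpi φ ν g) → u q = h.2.choose := fun q h => dif_pos h
  have hum : ∀ q, Measurable (u q) := by
    intro q
    by_cases h : q ∈ valueEpi φ ν g
    · rw [hu q h]
      exact h.2.choose_spec.1
    · simp only [u, h, dite_false]
      exact measurable_zero
  have hev : ∀ᶠ q in (U : Filter ((ℝ × ℝ) × ℝ)), q ∈ valueEpi φ ν g := hmem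
  have hT : Tendsto (fun q : (ℝ × ℝ) × ℝ => q.2) U (𝓝 p.2) :=
    (continuous_snd.tendsto p).mono_left hU
  obtain ⟨v, hvm, hvi, hvt, hv⟩ := exists_tendsto_integral_mul hφ hφ' U
    (fun q => (hum q).aestronglyMeasurable) hT (by
      filter_upwards [hev] with q hq
      rw [hu q hq]
      exact ⟨hq.1, hq.2.choose_spec.2.1⟩)
  refine ⟨ge_of_tendsto hT (hev.mono fun q hq => hq.1), v, hvm, hvt, ?_, ?_⟩
  · refine tendsto_nhds_unique (hv g hg)
      (((continuous_fst.comp continuous_fst).tendsto p |>.mono_left hU).congr' ?_)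
    filter_upwards [hev] with q hq
    rw [hu q hq]
    exact hq.2.choose_spec.2.2.1.symm
  · have h1 := hv (fun _ => 1) (heartFun_const 1)
    simp only [mul_one] at h1
    refine tendsto_nhds_unique h1
      (((continuous_snd.comp continuous_fst).tendsto p |>.mono_left hU).congr' ?_)
    filter_upwards [hev] with q hq
    rw [hu q hq]
    exact hq.2.choose_spec.2.2.2.symm

/-- The hard half of duality: the slopes of the separating affine function are the dual variables,
`t` for the constraint on `∫ u g` and `lam` for the normalisation `∫ u = 0`. -/
theorem lt_conj_cgf_of_notMem {g : Ω →ₘ[ν] ℝ} (hg : g ∈ stronglySubexp φ ν) {ε r : ℝ}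
    (h : ((ε, 0), r) ∉ valueEpi φ ν g) : (r : EReal) < conj (cgf φ ν g) ε := by
  rw [mem_stronglySubexp_iff hφ hφ'] at hg
  obtain ⟨l, c, hl, hc⟩ := exists_affine_minorant (convex_valueEpi hφ hφ' hg)
    (isClosed_valueEpi hφ hφ' hg)
    (fun x s s' ⟨h0, u, h1, h2, h3⟩ hss => ⟨h0.trans hss, u, h1,
      h2.trans (ENNReal.ofReal_le_ofReal hss), h3⟩)
    (zero_mem_valueEpi hφ g) (fun p hp => hp.1) h
  set t := l (1, 0) with ht
  set lam := l (0, 1) with hlam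
  have hlin : ∀ x y : ℝ, l (x, y) = x * t + y * lam := by
    intro x y
    have : (x, y) = x • ((1 : ℝ), (0 : ℝ)) + y • ((0 : ℝ), (1 : ℝ)) := by simp
    rw [this, map_add, map_smul, map_smul, smul_eq_mul, smul_eq_mul]
  have hgi := hg.integrable hφ hφ'
  have hc0 : 0 ≤ c := by
    have := hl _ (zero_mem_valueEpi hφ g)
    simpa using this
  -- Every simple pair with `ψ(u) ≤ s` yields the point `((∫ u g, ∫ u), ∫ s)` of the epigraph, where
  -- the separating inequality is the bound that the interchange lemma requires.
  have hint : ∫⁻ ω, ENNReal.ofReal (legendre φ (t * g ω + lam)) ∂ν ≤ ENNReal.ofReal c := by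
    refine lintegral_legendre_le hφ hφ' ((g.measurable.const_mul t).add_const lam)
      ((hgi.const_mul t).add (integrable_const lam)) fun u s hus => ?_
    have hs0 : ∀ ω, 0 ≤ s ω := fun ω => hφ.psi_nonneg (hus ω)
    have hsi : Integrable s ν := s.integrable_of_isFiniteMeasure
    have hmem : ((∫ ω, u ω * g ω ∂ν, ∫ ω, u ω ∂ν), ∫ ω, s ω ∂ν) ∈ valueEpi φ ν g := by
      refine ⟨integral_nonneg hs0, u, u.measurable, ?_, rfl, rfl⟩
      rw [ofReal_integral_eq_lintegral_ofReal hsi (ae_of_all _ hs0)]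
      exact lintegral_mono fun ω => EReal.toENNReal_le_toENNReal (hus ω)
    have h1 := hl _ hmem
    rw [hlin] at h1
    have hui : Integrable u ν := u.integrable_of_isFiniteMeasure
    have hugi := integrable_simpleFunc_mul hgi u
    have hsum : Integrable (fun ω => u ω * g ω * t + u ω * lam) ν :=
      (hugi.mul_const t).add (hui.mul_const lam)
    have h2 : ∫ ω, (u ω * (t * g ω + lam) - s ω) ∂ν =
        (∫ ω, u ω * g ω ∂ν) * t + (∫ ω, u ω ∂ν) * lam - ∫ ω, s ω ∂ν := by
      rw [← integral_mul_const, ← integral_mul_const,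
        ← integral_add (hugi.mul_const t) (hui.mul_const lam),
        ← integral_sub hsum hsi]
      congr 1 with ω
      ring
    rw [h2]
    exact h1
  have hcgf : cgf φ ν g t ≤ (c : EReal) := by
    rw [cgf_eq hφ hφ']
    exact (iInf_le _ lam).trans (coe_ennreal_le_coe_iff.2 ⟨hc0, hint⟩)
  have h1 : ((t * ε : ℝ) : EReal) - (c : EReal) ≤ conj (cgf φ ν g) ε :=
    (EReal.sub_le_sub le_rfl hcgf).trans (sub_le_conj (cgf φ ν g) t ε)
  refine lt_of_lt_of_le ?_ h1
  rw [← EReal.coe_sub, EReal.coe_lt_coe_iff]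
  rw [hlin] at hc
  linarith

omit [IsFiniteMeasure ν] in
-- Weak duality: Young's inequality for `t g + lam`, where `lam` drops out because the centred
-- density of a probability measure integrates to `0`.
theorem conj_cgf_le_div [IsProbabilityMeasure ν] {g : Ω →ₘ[ν] ℝ} (hg : g ∈ stronglySubexp φ ν)
    {μ : SignedMeasure Ω} (hμ : μ ∈ probs Ω) :
    conj (cgf φ ν g) (sint μ g - ∫ ω, g ω ∂ν) ≤ div φ μ ν := by
  rw [mem_stronglySubexp_iff hφ hφ'] at hg
  refine EReal.le_of_forall_lt_iff_le.1 fun r hr => ?_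
  have hball : μ ∈ ball φ ν r := hr.le
  obtain ⟨_, _, hr0, hI⟩ := mem_ball hφ hφ' hball
  have hum : AEStronglyMeasurable (fun ω => μ.rnDeriv ν ω - 1) ν :=
    (measurable_rnDeriv_sub_one μ).aestronglyMeasurable
  have h1 : ∫ ω, (μ.rnDeriv ν ω - 1) ∂ν = 0 := by
    have := univ_eq_of_mem_ball hφ hφ' hball
    rw [hμ.2, probReal_univ] at this
    linarith
  have h2 := sint_eq_of_mem_ball hφ hφ' hball hg
  rw [conj_le_coe_iff]
  intro t s hs
  -- The slack `d` produces an actual `lam`, as the infimum defining `cgf` may not be attained.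
  refine le_of_forall_pos_le_add fun d hd => ?_
  have h3 : cgf φ ν g t < ((s + d : ℝ) : EReal) :=
    hs.trans_lt (by rw [EReal.coe_lt_coe_iff]; linarith)
  rw [cgf_eq hφ hφ', iInf_lt_iff] at h3
  obtain ⟨lam, h3⟩ := h3
  obtain ⟨hsd, h4⟩ := coe_ennreal_le_coe_iff.1 h3.le
  have hh : HeartFun φ ν fun ω => t * g ω + lam :=
    (hg.const_mul t).add hφ hφ' (heartFun_const lam)
  have h5 : ∫ ω, legendre φ (t * g ω + lam) ∂ν ≤ s + d := by
    rw [← ofReal_integral_eq_lintegral_ofReal (hh.integrable_legendre hφ hφ')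
      (ae_of_all _ fun ω => legendre_nonneg hφ _)] at h4
    exact (ENNReal.ofReal_le_ofReal_iff hsd).1 h4
  have h6 := (integral_mul_le hφ hφ' hum hr0 hI hh).2.2
  have hui : Integrable (fun ω => μ.rnDeriv ν ω - 1) ν :=
    (SignedMeasure.integrable_rnDeriv μ ν).sub (integrable_const 1)
  have h7 : ∫ ω, (μ.rnDeriv ν ω - 1) * (t * g ω + lam) ∂ν =
      t * ∫ ω, (μ.rnDeriv ν ω - 1) * g ω ∂ν + lam * ∫ ω, (μ.rnDeriv ν ω - 1) ∂ν := by
    rw [← integral_const_mul, ← integral_const_mul, ← integral_add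
      ((integral_mul_le hφ hφ' hum hr0 hI hg).1.const_mul t)
      (hui.const_mul lam)]
    congr 1 with ω
    ring
  rw [h7, h1, mul_zero, add_zero] at h6
  rw [h2, add_sub_cancel_right]
  linarith

omit [IsFiniteMeasure ν] in
theorem optLB_eq_conj_cgf [IsProbabilityMeasure ν] {g : Ω →ₘ[ν] ℝ}
    (hg : g ∈ stronglySubexp φ ν) {M : Set (SignedMeasure Ω)}
    (hM : ∀ μ ∈ M, μ ∈ probs Ω)
    (hM' : ∀ μ ∈ probs Ω, μ.totalVariation ≪ ν → div φ μ ν < ⊤ → μ ∈ M) :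
    optLB φ ν M g = conj (cgf φ ν g) := by
  ext ε
  apply le_antisymm
  · refine le_of_forall_lt fun c hc => ?_
    obtain ⟨r, hcr, hr⟩ := EReal.lt_iff_exists_real_btwn.1 hc
    -- Were `((ε, 0), r)` in the epigraph, the measure with density `v + 1` would be a competitor of
    -- divergence at most `r`, below the optimal bound; it lies in `M` because its divergence is
    -- finite.
    refine hcr.trans (lt_conj_cgf_of_notMem hφ hφ' hg fun ⟨hr0, v, hvm, hvr, hvg, hv1⟩ => ?_)
    refine not_le.2 hr ?_
    have hgH := (mem_stronglySubexp_iff hφ hφ').1 hg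
    have hvi : Integrable v ν := by
      simpa using (integral_mul_le hφ hφ' hvm.aestronglyMeasurable hr0 hvr
        (heartFun_const (ν := ν) (φ := φ) 1)).1
    obtain ⟨hfi, hf0, hfd⟩ := div_withDensityᵥ_one_add_le hφ hvi hr0 hvr
    have hvgi := (integral_mul_le hφ hφ' hvm.aestronglyMeasurable hr0 hvr hgH).1
    have hprob : (ν.withDensityᵥ fun ω => v ω + 1) ∈ probs Ω := by
      refine withDensityᵥ_mem_probs hfi hf0 ?_
      rw [integral_add hvi (integrable_const 1), hv1]
      simp
    have hball : (ν.withDensityᵥ fun ω => v ω + 1) ∈ ball φ ν r := hfd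
    have hsint : sint (ν.withDensityᵥ fun ω => v ω + 1) g - ∫ ω, g ω ∂ν = ε := by
      rw [sint_withDensityᵥ hfi hf0]
      simp only [add_mul, one_mul]
      rw [integral_add hvgi (hgH.integrable hφ hφ'), add_sub_cancel_right]
      exact hvg
    exact (iInf₂_le _ ⟨hM' _ hprob (ball_absolutelyContinuous hφ hφ' hball)
      (hfd.trans_lt (EReal.coe_lt_top r)), ball_integrable hφ hφ' hball hgH, hsint⟩).trans hfd
  · refine le_iInf₂ fun μ ⟨hμM, _, hμ⟩ => ?_
    rw [← hμ]
    exact conj_cgf_le_div hφ hφ' hg (hM μ hμM)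

end Duality

end PhiDiv

theorem mainTheorem5 {Ω : Type*} [MeasurableSpace Ω] (ν : Measure Ω) [IsProbabilityMeasure ν]
    (φ : ℝ → EReal) (hφ : PhiDiv.IsGenerator φ)
    (hφ' : Tendsto (fun x : ℝ => φ x / (x : EReal)) atTop (𝓝 ⊤)) :
    -- `S(ν)` is the Orlicz heart of `θ`, in separating duality with `L^{θ*}(ν)`
    PhiDiv.stronglySubexp φ ν = PhiDiv.orliczHeart (PhiDiv.theta φ) ν ∧
    PhiDiv.SeparatingPairing ν (PhiDiv.orliczSpace (PhiDiv.conj (PhiDiv.theta φ)) ν)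
      (PhiDiv.stronglySubexp φ ν) ∧
    -- every `f ∈ L^{θ*}(ν)` is the density of a measure, and `D(f ν‖ν) = ∫ φ ∘ f dν`
    (∀ f ∈ PhiDiv.orliczSpace (PhiDiv.conj (PhiDiv.theta φ)) ν,
      Integrable f ν ∧ PhiDiv.div φ (ν.withDensityᵥ f) ν = (PhiDiv.intFun φ ν f : EReal)) ∧
    -- inf-compactness for `σ(L^{θ*}(ν), S(ν))`
    PhiDiv.InfCompact
      (PhiDiv.weakTopology ν (PhiDiv.orliczSpace (PhiDiv.conj (PhiDiv.theta φ)) ν)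
        (PhiDiv.stronglySubexp φ ν))
      (fun f : PhiDiv.orliczSpace (PhiDiv.conj (PhiDiv.theta φ)) ν =>
        (PhiDiv.intFun φ ν f.1 : EReal)) ∧
    -- information balls, and their intersections with the probability measures, are compact
    (∀ τ : ℝ,
      (∀ μ ∈ PhiDiv.ball φ ν τ, μ.totalVariation ≪ ν ∧
        ∀ g ∈ PhiDiv.stronglySubexp φ ν, Integrable g μ.totalVariation) ∧
      @CompactSpace (PhiDiv.ball φ ν τ)
        (PhiDiv.initialTopology (PhiDiv.stronglySubexp φ ν) (PhiDiv.ball φ ν τ)) ∧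
      @CompactSpace ↥(PhiDiv.probs Ω ∩ PhiDiv.ball φ ν τ)
        (PhiDiv.initialTopology (PhiDiv.stronglySubexp φ ν)
          (PhiDiv.probs Ω ∩ PhiDiv.ball φ ν τ))) ∧
    -- lower semicontinuity of the optimal lower bound, and strong duality
    (∀ g ∈ PhiDiv.stronglySubexp φ ν, ∀ M : Set (SignedMeasure Ω), Convex ℝ M →
      (∀ μ ∈ M, μ ∈ PhiDiv.probs Ω ∧ μ.totalVariation ≪ ν) →
      (∀ μ ∈ PhiDiv.probs Ω, μ.totalVariation ≪ ν → PhiDiv.div φ μ ν < ⊤ → μ ∈ M) →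
      LowerSemicontinuous (PhiDiv.optLB φ ν M g) ∧
      ∀ ε : ℝ,
        PhiDiv.optLB φ ν M g ε = PhiDiv.conj (PhiDiv.conj (PhiDiv.optLB φ ν M g)) ε ∧
        PhiDiv.optLB φ ν M g ε = PhiDiv.conj (PhiDiv.cgf φ ν g) ε) := by
  refine ⟨?_, PhiDiv.separatingPairing hφ hφ', fun f hf => ?_,
    PhiDiv.infCompact_intFun hφ hφ', fun τ => ⟨fun μ hμ => ?_,
    PhiDiv.compactSpace_ball hφ hφ' τ, PhiDiv.compactSpace_probs_inter_ball hφ hφ' τ⟩,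
    fun g hg M _ hM hM' => ?_⟩
  · ext g
    rw [PhiDiv.mem_stronglySubexp_iff hφ hφ', PhiDiv.mem_orliczHeart_iff hφ hφ']
  · have hfi : Integrable f ν := by
      simpa using PhiDiv.integrable_mul_of_mem_orliczSpace hφ hφ' hf (PhiDiv.heartFun_const 1)
    exact ⟨hfi, PhiDiv.div_withDensityᵥ hfi⟩
  · exact ⟨PhiDiv.ball_absolutelyContinuous hφ hφ' hμ, fun g hg =>
      PhiDiv.ball_integrable hφ hφ' hμ ((PhiDiv.mem_stronglySubexp_iff hφ hφ').1 hg)⟩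
  -- Once the bound is a conjugate, its lower semicontinuity and biconjugacy (`f*** = f*`) are
  -- automatic.
  · rw [PhiDiv.optLB_eq_conj_cgf hφ hφ' hg (fun μ hμ => (hM μ hμ).1) hM']
    exact ⟨PhiDiv.lowerSemicontinuous_conj _, fun ε =>
      ⟨(PhiDiv.conj_conj_conj _ ε).symm, rfl⟩⟩
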